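/- Equip $\mathbb{R}^{2n}=\mathbb{R}^n_x\times\mathbb{R}^n_\xi$ with the Euclidean norm. For $b\in C^\infty(\mathbb{R}^{2n};\mathbb{R})$ let $H_b=\nabla_\xi b\cdot\partial_x-\nabla_x b\cdot\partial_\xi$ be its Hamilton vector field, also regarded as a map $\mathbb{R}^{2n}\to\mathbb{R}^{2n}$, and let $e^{tH_b}$ be its flow. For $T>0$ put $$\langle a\rangle_{b,T}(X)=\frac1{2T}\int_{-T}^{T}a\big(e^{tH_b}(X)\big)\,dt .$$ Write $S(1)$ for the smooth complex-valued functions all of whose derivatives of every order $\ge 0$ are bounded. Let $p_0\in S(1)$ on $\mathbb{R}^{2n}$, with $p_0(0)=0$, and $T>0$ satisfy: (i) $\operatorname{Re}p_0\ge 0$; (ii) $\partial^\alpha p_0\in L^\infty$ for $|\alpha|\ge 2$, and $|\operatorname{Im}p_0|\le C(1+\operatorname{Re}p_0)$ for some $C>0$ (both are automatic for $p_0\in S(1)$); (iii) there is $C>0$ such that $\operatorname{Re}p_0(X)\ge 1/C$ whenever $|X|\ge C$; (iv) $\{X:\operatorname{Re}p_0(X)=0,\ H_{\operatorname{Im}p_0}(X)=0\}=\{0\}$;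 (v) with $q(X)=\tfrac12 p_0''(0)(X,X)$ the quadratic approximation of $p_0$ at $0$, $\langle\operatorname{Re}q\rangle_{\operatorname{Im}q,T}(X)>0$ for all $X\ne 0$; (vi) for every $d>0$ there is $e>0$ such that $\langle\operatorname{Re}p_0\rangle_{\operatorname{Im}p_0,T}(X)>e$ whenever $|X|>d$. Let $\widetilde p_0\in S(1)$ on $\mathbb{C}^{2n}$ be an almost holomorphic extension of $p_0$, i.e. $\widetilde p_0|_{\mathbb{R}^{2n}}=p_0$ and $\overline\partial\,\widetilde p_0(X+iY)=O(|Y|^\infty)$ as $|Y|\to 0$, and suppose that $\widetilde p_0$ is supported in a tube $\{X+iY:|Y|\le r\}$. Then there are constants $C,\epsilon_0,\delta_0>0$ and functions $G_\epsilon\in C_c^\infty(\mathbb{R}^{2n};\mathbb{R})$, $0<\epsilon\le\epsilon_0$, such that for all $0<\epsilon\le\epsilon_0$ $$|\partial^\alpha G_\epsilon(X)|\le C\,\epsilon^{1-|\alpha|/2},\qquad |\alpha|\le 2,\ X\in\mathbb{R}^{2n},$$ and for all $0<\epsilon\le\epsilon_0$ and $0<\delta\le\delta_0$ $$\operatorname{Re}\widetilde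 p_0\big(X+i\delta H_{G_\epsilon}(X)\big)\ge\frac{\delta|X|^2}{C}\quad\text{for }|X|\le\epsilon^{1/2},\qquad \operatorname{Re}\widetilde p_0\big(X+i\delta H_{G_\epsilon}(X)\big)\ge\frac{\delta\epsilon}{C}\quad\text{for }|X|\ge\epsilon^{1/2}.$$ -/

import Mathlib

open scoped ContDiff

noncomputable section

namespace PhaseSpaceWeights

/-- The real phase space `ℝ²ⁿ = ℝⁿ_x × ℝⁿ_ξ` with its Euclidean norm. The coordinate `x_j` has
index `Sum.inl j`, the coordinate `ξ_j` has index `Sum.inr j`. -/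
abbrev Phase (n : ℕ) : Type := EuclideanSpace ℝ (Fin n ⊕ Fin n)

/-- The complexified phase space `ℂ²ⁿ`. -/
abbrev CPhase (n : ℕ) : Type := EuclideanSpace ℂ (Fin n ⊕ Fin n)

variable {n : ℕ}

/-- The point `X + iY` of `ℂ²ⁿ`, for `X, Y ∈ ℝ²ⁿ`. -/
def complexPoint (X Y : Phase n) : CPhase n :=
  WithLp.toLp 2 fun j => (X j : ℂ) + Complex.I * (Y j : ℂ)

/-- The imaginary part `Y` of a point `X + iY` of `ℂ²ⁿ`. -/
def imPart (Z : CPhase n) : Phase n :=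
  WithLp.toLp 2 fun j => (Z j).im

/-- The Hamilton vector field `H_b = ∇_ξ b · ∂_x - ∇_x b · ∂_ξ`. -/
def hamVec (b : Phase n → ℝ) (X : Phase n) : Phase n :=
  WithLp.toLp 2 <| Sum.elim
    (fun j => fderiv ℝ b X (EuclideanSpace.single (Sum.inr j) 1))
    (fun j => -fderiv ℝ b X (EuclideanSpace.single (Sum.inl j) 1))

/-- `γ` is a complete integral curve of `H_b` that starts at `X`. -/
def IsHamCurve (b : Phase n → ℝ) (X : Phase n) (γ : ℝ → Phase n) : Prop :=
  γ 0 = X ∧ ∀ t : ℝ, HasDerivAt γ (hamVec b (γ t)) t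

open Classical in
/-- The Hamiltonian flow `e^{tH_b}(X)`: the value at time `t` of the complete integral curve of
`H_b` through `X`. Such a curve exists and is unique if `H_b` is globally Lipschitz, as it is for
every `b` that has bounded second derivatives; the value `X` where there is none is a dummy. -/
def hamFlow (b : Phase n → ℝ) (t : ℝ) (X : Phase n) : Phase n :=
  if h : ∃ γ : ℝ → Phase n, IsHamCurve b X γ then h.choose t else X

/-- The average `⟨a⟩_{b,T}(X) = (2T)⁻¹ ∫_{-T}^{T} a(e^{tH_b}(X)) dt`. -/
def flowAverage (a b : Phase n → ℝ) (T : ℝ) (X : Phase n) : ℝ :=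
  1 / (2 * T) * ∫ t in (-T)..T, a (hamFlow b t X)

/-- The quadratic approximation at the origin, i.e. the part of degree two of the Taylor
expansion, `q(X) = p''(0)(X, X) / 2`. -/
def quadApprox (p : Phase n → ℂ) (X : Phase n) : ℂ :=
  (1 / 2 : ℂ) * iteratedFDeriv ℝ 2 p 0 (fun _ => X)

/-- The symbol class `S(m)`: smooth functions all of whose (real) derivatives are `O(m)`. -/
def SymbolClass {E : Type*} [NormedAddCommGroup E] [NormedSpace ℝ E]
    (m : E → ℝ) (a : E → ℂ) : Prop :=
  ContDiff ℝ ∞ a ∧ ∀ k : ℕ, ∃ C : ℝ, ∀ X : E, ‖iteratedFDeriv ℝ k a X‖ ≤ C * m X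

/-- The antiholomorphic derivative `∂f/∂z̄_j = (∂f/∂x_j + i ∂f/∂y_j) / 2` on `ℂ²ⁿ`. -/
def dbar (f : CPhase n → ℂ) (j : Fin n ⊕ Fin n) (Z : CPhase n) : ℂ :=
  (1 / 2 : ℂ) * (fderiv ℝ f Z (EuclideanSpace.single j 1)
    + Complex.I * fderiv ℝ f Z (EuclideanSpace.single j Complex.I))

/-- `f` is an almost holomorphic extension of `p` from `ℝ²ⁿ` to `ℂ²ⁿ`: it is smooth, restricts to
`p`, and `∂̄f(X + iY) = O(|Y|^∞)` as `|Y| → 0`. -/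
def IsAlmostHolomorphicExtension (p : Phase n → ℂ) (f : CPhase n → ℂ) : Prop :=
  ContDiff ℝ ∞ f ∧ (∀ X : Phase n, f (complexPoint X 0) = p X) ∧
    ∀ (j : Fin n ⊕ Fin n) (N : ℕ), ∃ C : ℝ, ∀ Z : CPhase n,
      ‖imPart Z‖ ≤ 1 → ‖dbar f j Z‖ ≤ C * ‖imPart Z‖ ^ N

/-- The assumptions on the principal symbol `p` and the averaging time `T`. -/
structure PrincipalSymbolAssumptions (p : Phase n → ℂ) (T : ℝ) : Prop where
  smooth : ContDiff ℝ ∞ p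
  re_nonneg : ∀ X, 0 ≤ (p X).re
  deriv_bounded : ∀ k : ℕ, 2 ≤ k → ∃ C : ℝ, ∀ X, ‖iteratedFDeriv ℝ k p X‖ ≤ C
  im_le : ∃ C : ℝ, 0 < C ∧ ∀ X, |(p X).im| ≤ C * (1 + (p X).re)
  elliptic_at_infinity : ∃ C : ℝ, 0 < C ∧ ∀ X, C ≤ ‖X‖ → 1 / C ≤ (p X).re
  critical_set : {X | (p X).re = 0 ∧ hamVec (fun Y => (p Y).im) X = 0} = {0}
  map_zero : p 0 = 0
  time_pos : 0 < T
  quadratic_average_pos : ∀ X, X ≠ 0 →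
    0 < flowAverage (fun Y => (quadApprox p Y).re) (fun Y => (quadApprox p Y).im) T X
  average_pos : ∀ d : ℝ, 0 < d → ∃ e : ℝ, 0 < e ∧ ∀ X, d < ‖X‖ →
    e < flowAverage (fun Y => (p Y).re) (fun Y => (p Y).im) T X

end PhaseSpaceWeights

end

/-! Write `a = Re p₀`, `v = H_{Im p₀}`, `S = 2T` and `μ = ε|X|²/(ε + |X|²)`, which is comparable to
`min(|X|², ε)`. Almost holomorphy at real points and the antisymmetry of the Poisson bracket give
`Re p̃₀(X + iδH_G) = a + δ dG(v) + O(δ²|∇G|²)`. It is therefore enough to find an escape function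
`G` with `dG(v) ≥ -a + c'μ` and `|∇G|² ≤ Cμ` on a ball: for small `δ` the remainder costs half of
`δc'μ`, and `(1 - δ)a ≥ 0` is dropped. Outside the ball `a` is bounded below and a small
perturbation cannot destroy this.

In continuous time one would take `G = ∫₀^S (1 - t/S) k(e^{tv}X) dt` with the truncation `k = εa/(ε
+ |X|²)`. Differentiating along `v` and integrating by parts gives `-k(X) + (1/S) ∫₀^S k(e^{tv}X)
dt`. Here `k ≤ a`. Since `|e^{tv}X|` is at most a constant times `|X|`, the average of `k` is at
least a constant times `ε/(ε + |X|²)` times the average of `a`, and the latter dominates `|X|²` on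
the ball: near 0 by comparison with the quadratic approximation, elsewhere by the averaging
hypothesis.

The proof replaces the flow by `N` explicit Euler steps. The iterates are compositions of smooth
maps, so no differentiability of the flow in its initial point is needed; the integration by parts
becomes an Abel summation, and all discretization errors are `O(1/N)` times `μ` or `|X|²`. Hence one
fixed `N`, independent of `ε`, suffices, and the scaled derivative bounds of `k` pass to `G` after a
fixed cutoff. The main lemmas are `exists_integral_curve_lower_bound`, `EscapeData.exists_step_le`,
`EscapeData.exists_discreteAverage` and `IsAlmostHolomorphicExtension.le_re_complexPoint`. -/

namespace PhaseSpaceWeights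

/-! ### Integral curves: global existence, Grönwall comparison, growth. -/

section Flow

variable {E : Type*} [NormedAddCommGroup E] [NormedSpace ℝ E]

open scoped NNReal in
/-- A bounded, globally Lipschitz vector field has complete integral curves. -/
theorem exists_integralCurve_of_bounded [CompleteSpace E] {v : E → E} {K : ℝ≥0} {M : ℝ}
    (hv : LipschitzWith K v) (hM : ∀ x, ‖v x‖ ≤ M) (x : E) :
    ∃ γ : ℝ → E, γ 0 = x ∧ ∀ t, HasDerivAt γ (v (γ t)) t := by
  have hM0 : 0 ≤ M := (norm_nonneg _).trans (hM x)
  -- Boundedness of the field lets Picard-Lindelöf run on any interval `(-m, m)`; uniqueness then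
  -- glues the pieces.
  have key : ∀ m : ℝ, ∃ γ : ℝ → E, γ 0 = x ∧
      ∀ t ∈ Set.Ioo (-m) m, HasDerivAt γ (v (γ t)) t := by
    intro m
    rcases le_or_gt m 0 with hm | hm
    · exact ⟨fun _ => x, rfl, fun t ht => by linarith [ht.1, ht.2]⟩
    have h0 : (0 : ℝ) ∈ Set.Icc (-m) m := ⟨by linarith, hm.le⟩
    have hpl : IsPicardLindelof (fun _ : ℝ => v) (tmin := -m) (tmax := m) ⟨0, h0⟩ x
        (M.toNNReal * m.toNNReal) 0 M.toNNReal K := by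
      apply IsPicardLindelof.of_time_independent
      · intro y _
        rw [Real.coe_toNNReal _ hM0]
        exact hM y
      · exact hv.lipschitzOnWith
      · simp [Real.coe_toNNReal _ hM0, Real.coe_toNNReal _ hm.le]
    obtain ⟨γ, hγ0, hγ⟩ := hpl.exists_eq_forall_mem_Icc_hasDerivWithinAt₀
    exact ⟨γ, hγ0, fun t ht => (hγ t ⟨ht.1.le, ht.2.le⟩).hasDerivAt (Icc_mem_nhds ht.1 ht.2)⟩
  choose γ hγ0 hγ using key
  have huniq : ∀ m m' t : ℝ, t ∈ Set.Ioo (-m) m → m ≤ m' → γ m t = γ m' t := by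
    intro m m' t ht hmm
    have hm : 0 < m := by linarith [ht.1, ht.2]
    exact ODE_solution_unique_of_mem_Ioo (v := fun _ => v) (s := fun _ => Set.univ) (K := K)
      (t₀ := 0) (fun _ _ => hv.lipschitzOnWith) ⟨by linarith, hm⟩
      (fun s hs => ⟨hγ m s hs, trivial⟩)
      (fun s hs => ⟨hγ m' s ⟨by linarith [hs.1], by linarith [hs.2]⟩, trivial⟩)
      (by rw [hγ0, hγ0]) ht
  -- The index `|t| + 1` keeps `t` strictly inside the interval of its own piece.
  refine ⟨fun t => γ (|t| + 1) t, by simp [hγ0], fun t => ?_⟩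
  have hmem : ∀ s : ℝ, s ∈ Set.Ioo (-(|s| + 1)) (|s| + 1) := fun s =>
    ⟨by linarith [neg_abs_le s], by linarith [le_abs_self s]⟩
  refine (hγ _ t (hmem t)).congr_of_eventuallyEq ?_
  filter_upwards [Ioo_mem_nhds (hmem t).1 (hmem t).2] with s hs
  rcases le_total (|s| + 1) (|t| + 1) with h | h
  · exact huniq _ _ s (hmem s) h
  · exact (huniq _ _ s hs h).symm

/-- Two curves that satisfy the same linear-growth differential inequality stay close. -/
theorem norm_sub_le_of_deriv_sub_le {f g f' g' : ℝ → E} {K e S : ℝ} (hK : 0 ≤ K) (he : 0 ≤ e)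
    (hf : ∀ t, HasDerivAt f (f' t) t) (hg : ∀ t, HasDerivAt g (g' t) t) (h0 : f 0 = g 0)
    (hb : ∀ t ∈ Set.Ico 0 S, ‖f' t - g' t‖ ≤ K * ‖f t - g t‖ + e) :
    ∀ t ∈ Set.Icc 0 S, ‖f t - g t‖ ≤ e * gronwallBound 0 K 1 S := by
  intro t ht
  have h := norm_le_gronwallBound_of_norm_deriv_right_le (f := fun t => f t - g t)
    (f' := fun t => f' t - g' t) (δ := 0) (K := K) (ε := e) (a := 0) (b := S)
    (fun s _ => ((hf s).sub (hg s)).continuousAt.continuousWithinAt)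
    (fun s _ => ((hf s).sub (hg s)).hasDerivWithinAt) (by simp [h0]) hb t ht
  have h1 : gronwallBound 0 K e (t - 0) ≤ gronwallBound 0 K e S :=
    gronwallBound_mono le_rfl he hK (by simpa using ht.2)
  have h2 : gronwallBound 0 K e S = e * gronwallBound 0 K 1 S := by
    unfold gronwallBound
    split_ifs <;> ring
  linarith

theorem gronwallBound_zero_one_nonneg {K S : ℝ} (hK : 0 ≤ K) (hS : 0 ≤ S) :
    0 ≤ gronwallBound 0 K 1 S := by
  have := gronwallBound_mono (le_refl (0 : ℝ)) zero_le_one hK hS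
  simpa [gronwallBound_x0] using this

/-- Exponential growth bound for integral curves of a field of linear growth, forward in time. -/
theorem norm_curve_le_of_nonneg {v : E → E} {K : ℝ} {γ : ℝ → E} (hv : ∀ x, ‖v x‖ ≤ K * ‖x‖)
    (hγ : ∀ t, HasDerivAt γ (v (γ t)) t) {t : ℝ} (ht : 0 ≤ t) :
    ‖γ t‖ ≤ Real.exp (K * t) * ‖γ 0‖ := by
  have h := norm_le_gronwallBound_of_norm_deriv_right_le (f := γ)
    (f' := fun t => v (γ t)) (δ := ‖γ 0‖) (K := K) (ε := 0) (a := 0) (b := t)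
    (fun s _ => (hγ s).continuousAt.continuousWithinAt)
    (fun s _ => (hγ s).hasDerivWithinAt) le_rfl (fun s _ => by simpa using hv _) t ⟨ht, le_rfl⟩
  rw [gronwallBound_ε0, sub_zero] at h
  linarith

theorem hasDerivAt_reverse {v : E → E} {γ : ℝ → E} (hγ : ∀ t, HasDerivAt γ (v (γ t)) t) (s : ℝ) :
    ∀ t, HasDerivAt (fun t => γ (s - t)) (-v (γ (s - t))) t := by
  intro t
  have h := (hγ (s - t)).scomp t ((hasDerivAt_id t).const_sub s)
  rw [neg_one_smul] at h
  exact h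

theorem norm_curve_le {v : E → E} {K : ℝ} {γ : ℝ → E} (hv : ∀ x, ‖v x‖ ≤ K * ‖x‖)
    (hγ : ∀ t, HasDerivAt γ (v (γ t)) t) (t : ℝ) :
    ‖γ t‖ ≤ Real.exp (K * |t|) * ‖γ 0‖ := by
  rcases le_total 0 t with ht | ht
  · simpa [abs_of_nonneg ht] using norm_curve_le_of_nonneg hv hγ ht
  · have := norm_curve_le_of_nonneg (v := fun x => -v x) (γ := fun t => γ (0 - t))
      (by simpa using hv) (hasDerivAt_reverse hγ 0) (t := -t) (by linarith)
    simpa [abs_of_nonpos ht] using this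

theorem norm_zero_le_curve {v : E → E} {K : ℝ} {γ : ℝ → E} (hv : ∀ x, ‖v x‖ ≤ K * ‖x‖)
    (hγ : ∀ t, HasDerivAt γ (v (γ t)) t) {t : ℝ} (ht : 0 ≤ t) :
    ‖γ 0‖ ≤ Real.exp (K * t) * ‖γ t‖ := by
  have := norm_curve_le_of_nonneg (v := fun x => -v x) (γ := fun s => γ (t - s))
      (by simpa using hv) (hasDerivAt_reverse hγ t) (t := t) ht
  simpa using this

end Flow

/-! ### Identification of `hamFlow` with concrete integral curves. -/

section HamFlow

variable {n : ℕ}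

-- The curve inside `hamFlow` is an arbitrary choice; for a Lipschitz field uniqueness makes the
-- choice irrelevant, so the flow can be computed from any curve at hand.
open scoped NNReal in
theorem hamFlow_eq {b : Phase n → ℝ} {K : ℝ≥0} (hb : LipschitzWith K (hamVec b)) {X : Phase n}
    {γ : ℝ → Phase n} (hγ : IsHamCurve b X γ) (t : ℝ) : hamFlow b t X = γ t := by
  have h : ∃ γ, IsHamCurve b X γ := ⟨γ, hγ⟩
  rw [hamFlow, dif_pos h]
  have := ODE_solution_unique_univ (v := fun _ => hamVec b) (s := fun _ => Set.univ) (t₀ := 0)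
    (fun _ => hb.lipschitzOnWith) (fun t => ⟨h.choose_spec.2 t, trivial⟩)
    (fun t => ⟨hγ.2 t, trivial⟩) (by rw [h.choose_spec.1, hγ.1])
  rw [this]

theorem flowAverage_eq {a b : Phase n → ℝ} {T : ℝ} {X : Phase n} {γ : ℝ → Phase n}
    (h : ∀ t, hamFlow b t X = γ t) :
    flowAverage a b T X = 1 / (2 * T) * ∫ t in (-T)..T, a (γ t) := by
  simp only [flowAverage, h]

end HamFlow

/-! ### First-order Taylor estimates (constants not sharp). -/

section Taylor

variable {E F : Type*} [NormedAddCommGroup E] [NormedSpace ℝ E] [NormedAddCommGroup F]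
  [NormedSpace ℝ F]

theorem norm_fderiv_fderiv (f : E → F) (x : E) :
    ‖fderiv ℝ (fderiv ℝ f) x‖ = ‖iteratedFDeriv ℝ 2 f x‖ := by
  rw [← norm_iteratedFDeriv_one, norm_iteratedFDeriv_fderiv]

theorem norm_fderiv_sub_le_of_segment {f : E → F} (hf : ContDiff ℝ ∞ f) {x y : E} {B : ℝ}
    (hB : ∀ z ∈ segment ℝ x y, ‖iteratedFDeriv ℝ 2 f z‖ ≤ B) :
    ‖fderiv ℝ f y - fderiv ℝ f x‖ ≤ B * ‖y - x‖ := by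
  have hd : Differentiable ℝ (fderiv ℝ f) :=
    (hf.fderiv_right (m := ∞) (by simp)).differentiable (by simp)
  exact (convex_segment x y).norm_image_sub_le_of_norm_fderiv_le (𝕜 := ℝ)
    (fun z _ => hd z) (fun z hz => by rw [norm_fderiv_fderiv]; exact hB z hz)
    (left_mem_segment ℝ x y) (right_mem_segment ℝ x y)

theorem norm_fderiv_sub_le {f : E → F} (hf : ContDiff ℝ ∞ f) {B : ℝ}
    (hB : ∀ z, ‖iteratedFDeriv ℝ 2 f z‖ ≤ B) (x y : E) :
    ‖fderiv ℝ f y - fderiv ℝ f x‖ ≤ B * ‖y - x‖ :=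
  norm_fderiv_sub_le_of_segment hf fun z _ => hB z

/-- First-order Taylor formula with a quadratic remainder. -/
theorem norm_taylor_one_le_of_segment {f : E → F} (hf : ContDiff ℝ ∞ f) {x y : E} {B : ℝ}
    (hB : ∀ z ∈ segment ℝ x y, ‖iteratedFDeriv ℝ 2 f z‖ ≤ B) :
    ‖f y - f x - fderiv ℝ f x (y - x)‖ ≤ B * ‖y - x‖ ^ 2 := by
  have hd : Differentiable ℝ f := hf.differentiable (by simp)
  have hB0 : 0 ≤ B := (norm_nonneg _).trans (hB x (left_mem_segment ℝ x y))
  have h := (convex_segment x y).norm_image_sub_le_of_norm_fderiv_le' (𝕜 := ℝ)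
    (f := f) (φ := fderiv ℝ f x) (C := B * ‖y - x‖)
    (fun z _ => hd z) (fun z hz => ?_)
    (left_mem_segment ℝ x y) (right_mem_segment ℝ x y)
  · rw [pow_two, ← mul_assoc]; exact h
  · have hsub : segment ℝ x z ⊆ segment ℝ x y :=
      (convex_segment x y).segment_subset (left_mem_segment ℝ x y) hz
    refine (norm_fderiv_sub_le_of_segment hf fun w hw => hB w (hsub hw)).trans ?_
    gcongr
    obtain ⟨s, hs, rfl⟩ := (segment_eq_image' ℝ x y ▸ hz :)
    rw [add_sub_cancel_left, norm_smul, Real.norm_of_nonneg hs.1]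
    exact mul_le_of_le_one_left (norm_nonneg _) hs.2

theorem norm_taylor_one_le {f : E → F} (hf : ContDiff ℝ ∞ f) {B : ℝ}
    (hB : ∀ z, ‖iteratedFDeriv ℝ 2 f z‖ ≤ B) (x y : E) :
    ‖f y - f x - fderiv ℝ f x (y - x)‖ ≤ B * ‖y - x‖ ^ 2 :=
  norm_taylor_one_le_of_segment hf fun z _ => hB z

end Taylor

/-! ### The symplectic map from covectors to vectors. -/

section HamVec

variable {n : ℕ}

/-- The symplectic duality that sends a covector `ℓ` to the vector `(ℓ_ξ, -ℓ_x)`. -/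
noncomputable def hamMap (n : ℕ) : (Phase n →L[ℝ] ℝ) →L[ℝ] Phase n :=
  LinearMap.toContinuousLinearMap
    { toFun := fun ℓ => WithLp.toLp 2 <| Sum.elim
        (fun j => ℓ (EuclideanSpace.single (Sum.inr j) 1))
        (fun j => -ℓ (EuclideanSpace.single (Sum.inl j) 1))
      map_add' := fun ℓ m => by
        ext (j | j) <;> simp <;> ring
      map_smul' := fun c ℓ => by
        ext (j | j) <;> simp }

theorem hamVec_eq (b : Phase n → ℝ) (X : Phase n) : hamVec b X = hamMap n (fderiv ℝ b X) := rfl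

theorem clm_apply_eq_sum (ℓ : Phase n →L[ℝ] ℝ) (X : Phase n) :
    ℓ X = ∑ j, X j * ℓ (EuclideanSpace.single j 1) := by
  conv_lhs => rw [← (EuclideanSpace.basisFun (Fin n ⊕ Fin n) ℝ).sum_repr X]
  simp

/-- Antisymmetry of the Poisson bracket; it later turns `-H_G(Im p)` into `H_{Im p}(G)`. -/
theorem apply_hamMap (ℓ m : Phase n →L[ℝ] ℝ) : ℓ (hamMap n m) = -m (hamMap n ℓ) := by
  rw [clm_apply_eq_sum ℓ, clm_apply_eq_sum m, Fintype.sum_sum_type, Fintype.sum_sum_type]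
  simp only [hamMap, LinearMap.coe_toContinuousLinearMap', LinearMap.coe_mk, AddHom.coe_mk,
    Sum.elim_inl, Sum.elim_inr]
  rw [neg_add, add_comm]
  congr 1 <;> rw [← Finset.sum_neg_distrib] <;> exact Finset.sum_congr rfl fun j _ => by ring

theorem eq_zero_of_hamMap_eq_zero {ℓ : Phase n →L[ℝ] ℝ} (h : hamMap n ℓ = 0) : ℓ = 0 := by
  have h1 : ∀ j, ℓ (EuclideanSpace.single j 1) = 0 := by
    rintro (j | j)
    · have := congrArg (fun v : Phase n => v (Sum.inr j)) h
      simpa [hamMap] using this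
    · have := congrArg (fun v : Phase n => v (Sum.inl j)) h
      simpa [hamMap] using this
  ext X
  rw [clm_apply_eq_sum]
  simp [h1]

end HamVec

/-! ### Taylor remainders of the quadratic approximation. -/

section QuadApprox

variable {n : ℕ}

theorem quadApprox_eq (p : Phase n → ℂ) (X : Phase n) :
    quadApprox p X = (1 / 2 : ℂ) * fderiv ℝ (fderiv ℝ p) 0 X X := by
  rw [quadApprox, iteratedFDeriv_two_apply]

/-- The product rule produces two terms; symmetry of the second derivative makes them equal and
cancels the factor 1/2. -/
theorem hasFDerivAt_quadApprox {p : Phase n → ℂ} (hp : ContDiff ℝ ∞ p) (X : Phase n) :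
    HasFDerivAt (quadApprox p) (fderiv ℝ (fderiv ℝ p) 0 X) X := by
  have hsymm : IsSymmSndFDerivAt ℝ p 0 :=
    (hp.contDiffAt).isSymmSndFDerivAt (by simpa using WithTop.coe_le_coe.2 (le_top : (2 : ℕ∞) ≤ ⊤))
  have h1 := ((fderiv ℝ (fderiv ℝ p) 0).hasFDerivAt_of_bilinear (hasFDerivAt_id X)
    (hasFDerivAt_id X)).const_mul (1 / 2 : ℂ)
  have h2 : quadApprox p = fun X => (1 / 2 : ℂ) * fderiv ℝ (fderiv ℝ p) 0 X X :=
    funext (quadApprox_eq p)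
  rw [h2]
  refine h1.congr_fderiv ?_
  ext Y
  simp only [smul_apply, add_apply, ContinuousLinearMap.precompR_apply,
    ContinuousLinearMap.compL_apply, ContinuousLinearMap.comp_apply, ContinuousLinearMap.precompL_apply, id,
    ContinuousLinearMap.id_apply, smul_eq_mul]
  rw [hsymm.eq Y X]
  ring

theorem norm_fderiv_sub_quadApprox_le {p : Phase n → ℂ} (hp : ContDiff ℝ ∞ p) {M : ℝ}
    (hM : ∀ X, ‖iteratedFDeriv ℝ 3 p X‖ ≤ M) (h0 : fderiv ℝ p 0 = 0) (X : Phase n) :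
    ‖fderiv ℝ p X - fderiv ℝ (fderiv ℝ p) 0 X‖ ≤ M * ‖X‖ ^ 2 := by
  have h := norm_taylor_one_le (f := fderiv ℝ p) (hp.fderiv_right (by simp))
    (B := M) (fun z => by rw [norm_iteratedFDeriv_fderiv]; exact hM z) 0 X
  simpa [h0] using h

theorem norm_sub_quadApprox_le {p : Phase n → ℂ} (hp : ContDiff ℝ ∞ p) {M : ℝ}
    (hM : ∀ X, ‖iteratedFDeriv ℝ 3 p X‖ ≤ M) (hp0 : p 0 = 0) (h0 : fderiv ℝ p 0 = 0)
    (X : Phase n) : ‖p X - quadApprox p X‖ ≤ M * ‖X‖ ^ 3 := by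
  have hM0 : 0 ≤ M := (norm_nonneg _).trans (hM 0)
  have h := (convex_segment 0 X).norm_image_sub_le_of_norm_hasFDerivWithin_le (𝕜 := ℝ)
    (f := fun X => p X - quadApprox p X) (C := M * ‖X‖ ^ 2)
    (fun z _ => ((hp.differentiable (by simp) z).hasFDerivAt.sub
      (hasFDerivAt_quadApprox hp z)).hasFDerivWithinAt) (fun z hz => ?_)
    (left_mem_segment ℝ 0 X) (right_mem_segment ℝ 0 X)
  · simp only [hp0, quadApprox_eq, map_zero, mul_zero, sub_zero] at h ⊢
    calc _ ≤ _ := h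
      _ = _ := by ring
  · refine (norm_fderiv_sub_quadApprox_le hp hM h0 z).trans ?_
    gcongr
    obtain ⟨s, hs, rfl⟩ := (segment_eq_image' ℝ 0 X ▸ hz :)
    simp only [sub_zero, zero_add, norm_smul, Real.norm_of_nonneg hs.1]
    exact mul_le_of_le_one_left (norm_nonneg _) hs.2

end QuadApprox

/-! ### Comparison with the linearized flow. -/

section Linear

variable {E : Type*} [NormedAddCommGroup E] [NormedSpace ℝ E]

/-- Integral curves of a vector field and of its linearization at an equilibrium differ by a term
that is quadratic in the initial point. -/
theorem exists_norm_curve_sub_linear_le {v : E → E} {F : E →L[ℝ] E} {K M S : ℝ} (hS : 0 ≤ S)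
    (hM : 0 ≤ M) (hv : ∀ x, ‖v x‖ ≤ K * ‖x‖) (hvF : ∀ x, ‖v x - F x‖ ≤ M * ‖x‖ ^ 2) (hK : 0 ≤ K) :
    ∃ C : ℝ, 0 ≤ C ∧ ∀ γ σ : ℝ → E, (∀ t, HasDerivAt γ (v (γ t)) t) →
      (∀ t, HasDerivAt σ (F (σ t)) t) → γ 0 = σ 0 → ∀ t, |t| ≤ S →
        ‖γ t - σ t‖ ≤ C * ‖γ 0‖ ^ 2 := by
  -- Quantified over the field again, so that negative times follow by applying it to `-v` and `-F`.
  have key : ∀ (v : E → E) (F : E →L[ℝ] E), (∀ x, ‖v x‖ ≤ K * ‖x‖) →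
      (∀ x, ‖v x - F x‖ ≤ M * ‖x‖ ^ 2) → ∀ γ σ : ℝ → E, (∀ t, HasDerivAt γ (v (γ t)) t) →
      (∀ t, HasDerivAt σ (F (σ t)) t) → γ 0 = σ 0 → ∀ t ∈ Set.Icc 0 S,
        ‖γ t - σ t‖ ≤ M * (Real.exp (K * S) * ‖γ 0‖) ^ 2 * gronwallBound 0 ‖F‖ 1 S := by
    intro v F hv hvF γ σ hγ hσ h0
    refine norm_sub_le_of_deriv_sub_le (norm_nonneg F) (by positivity) hγ hσ h0 fun t ht => ?_
    have h1 : ‖γ t‖ ≤ Real.exp (K * S) * ‖γ 0‖ := by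
      refine (norm_curve_le_of_nonneg hv hγ ht.1).trans ?_
      gcongr
      exact ht.2.le
    calc ‖v (γ t) - F (σ t)‖ = ‖F (γ t - σ t) + (v (γ t) - F (γ t))‖ := by
          rw [map_sub]; congr 1; abel
      _ ≤ ‖F (γ t - σ t)‖ + ‖v (γ t) - F (γ t)‖ := norm_add_le _ _
      _ ≤ ‖F‖ * ‖γ t - σ t‖ + M * ‖γ t‖ ^ 2 := add_le_add (F.le_opNorm _) (hvF _)
      _ ≤ _ := by gcongr
  refine ⟨M * Real.exp (K * S) ^ 2 * gronwallBound 0 ‖F‖ 1 S, ?_, fun γ σ hγ hσ h0 t ht => ?_⟩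
  · have := gronwallBound_zero_one_nonneg (norm_nonneg F) hS
    positivity
  · rcases le_total 0 t with h | h
    · refine (key v F hv hvF γ σ hγ hσ h0 t ⟨h, (le_abs_self t).trans ht⟩).trans_eq ?_
      ring
    · have := key (fun x => -v x) (-F) (by simpa using hv)
        (fun x => by
          have h1 : -v x - (-F) x = -(v x - F x) := by rw [neg_apply]; abel
          rw [h1, norm_neg]
          exact hvF x)
        (fun t => γ (0 - t)) (fun t => σ (0 - t)) (hasDerivAt_reverse hγ 0)
        (hasDerivAt_reverse (v := fun x => F x) hσ 0) (by simpa using h0) (-t)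
        ⟨by linarith, (neg_le_abs t).trans ht⟩
      simp only [sub_neg_eq_add, zero_add, sub_zero, norm_neg] at this
      refine this.trans_eq ?_
      ring

theorem hasDerivAt_exp_smul_apply [CompleteSpace E] (F : E →L[ℝ] E) (X : E) (t : ℝ) :
    HasDerivAt (fun t : ℝ => NormedSpace.exp (t • F) X) (F (NormedSpace.exp (t • F) X)) t := by
  have h := (hasDerivAt_exp_smul_const' (𝕂 := ℝ) F t).clm_apply (hasDerivAt_const t X)
  simpa using h

theorem exp_zero_smul_apply (F : E →L[ℝ] E) (X : E) : NormedSpace.exp ((0 : ℝ) • F) X = X := by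
  rw [zero_smul, NormedSpace.exp_zero]
  rfl

end Linear

/-! ### Quantitative positivity of the averages of `Re p`. -/

section Symbol

variable {n : ℕ} {p : Phase n → ℂ} {T : ℝ}

theorem fderiv_clm_comp {F : Type*} [NormedAddCommGroup F] [NormedSpace ℝ F] (L : ℂ →L[ℝ] F)
    (hp : ContDiff ℝ ∞ p) (X : Phase n) :
    fderiv ℝ (fun Y => L (p Y)) X = L.comp (fderiv ℝ p X) :=
  (L.hasFDerivAt.comp X (hp.differentiable (by simp) X).hasFDerivAt).fderiv

theorem PrincipalSymbolAssumptions.fderiv_re_zero (hp : PrincipalSymbolAssumptions p T) :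
    fderiv ℝ (fun Y => (p Y).re) 0 = 0 := by
  apply IsLocalMin.fderiv_eq_zero
  refine Filter.Eventually.of_forall fun X => ?_
  simpa [hp.map_zero] using hp.re_nonneg X

theorem PrincipalSymbolAssumptions.hamVec_zero (hp : PrincipalSymbolAssumptions p T) :
    hamVec (fun Y => (p Y).im) 0 = 0 := by
  have : (0 : Phase n) ∈ {X | (p X).re = 0 ∧ hamVec (fun Y => (p Y).im) X = 0} := by
    rw [hp.critical_set]; rfl
  exact this.2

/-- The origin is a minimum of `Re p ≥ 0`, and it lies in the critical set, where the Hamilton field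
of `Im p`, hence its differential, vanishes. -/
theorem PrincipalSymbolAssumptions.fderiv_zero (hp : PrincipalSymbolAssumptions p T) :
    fderiv ℝ p 0 = 0 := by
  have h1 := hp.fderiv_re_zero
  have h2 : fderiv ℝ (fun Y => (p Y).im) 0 = 0 := eq_zero_of_hamMap_eq_zero hp.hamVec_zero
  have h3 := fderiv_clm_comp Complex.reCLM hp.smooth 0
  have h4 := fderiv_clm_comp Complex.imCLM hp.smooth 0
  simp only [Complex.reCLM_apply, Complex.imCLM_apply] at h3 h4
  rw [h1] at h3
  rw [h2] at h4
  ext X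
  apply Complex.ext
  · simpa using (DFunLike.congr_fun h3 X).symm
  · simpa using (DFunLike.congr_fun h4 X).symm

theorem hamVec_im_eq (hp : ContDiff ℝ ∞ p) (X : Phase n) :
    hamVec (fun Y => (p Y).im) X = hamMap n (Complex.imCLM.comp (fderiv ℝ p X)) := by
  rw [hamVec_eq, ← fderiv_clm_comp Complex.imCLM hp]
  rfl

theorem norm_imCLM_comp_le (ℓ : Phase n →L[ℝ] ℂ) : ‖Complex.imCLM.comp ℓ‖ ≤ ‖ℓ‖ := by
  simpa using Complex.imCLM.opNorm_comp_le ℓ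

theorem norm_hamVec_im_sub_le (hp : ContDiff ℝ ∞ p) {M : ℝ}
    (hM : ∀ X, ‖iteratedFDeriv ℝ 2 p X‖ ≤ M) (X Y : Phase n) :
    ‖hamVec (fun Y => (p Y).im) X - hamVec (fun Y => (p Y).im) Y‖ ≤
      ‖hamMap n‖ * M * ‖X - Y‖ := by
  rw [hamVec_im_eq hp, hamVec_im_eq hp, ← map_sub, ← ContinuousLinearMap.comp_sub, mul_assoc]
  refine ((hamMap n).le_opNorm _).trans ?_
  gcongr
  exact (norm_imCLM_comp_le _).trans (norm_fderiv_sub_le hp hM Y X)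

theorem lipschitzWith_hamVec_im (hp : ContDiff ℝ ∞ p) {M : ℝ}
    (hM : ∀ X, ‖iteratedFDeriv ℝ 2 p X‖ ≤ M) :
    LipschitzWith (‖hamMap n‖ * M).toNNReal (hamVec (fun Y => (p Y).im)) := by
  have hM0 : 0 ≤ M := (norm_nonneg _).trans (hM 0)
  refine LipschitzWith.of_dist_le_mul fun X Y => ?_
  rw [dist_eq_norm, dist_eq_norm, Real.coe_toNNReal _ (by positivity)]
  exact norm_hamVec_im_sub_le hp hM X Y

theorem PrincipalSymbolAssumptions.norm_hamVec_im_le (hp : PrincipalSymbolAssumptions p T) {M : ℝ}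
    (hM : ∀ X, ‖iteratedFDeriv ℝ 2 p X‖ ≤ M) (X : Phase n) :
    ‖hamVec (fun Y => (p Y).im) X‖ ≤ ‖hamMap n‖ * M * ‖X‖ := by
  have := norm_hamVec_im_sub_le hp.smooth hM X 0
  simpa [hp.hamVec_zero] using this

/-- The linearization at the origin of the Hamilton field of `Im p`. -/
noncomputable def hamLin (p : Phase n → ℂ) : Phase n →L[ℝ] Phase n :=
  (hamMap n).comp ((ContinuousLinearMap.compL ℝ (Phase n) ℂ ℝ Complex.imCLM).comp
    (fderiv ℝ (fderiv ℝ p) 0))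

theorem hamLin_apply (p : Phase n → ℂ) (X : Phase n) :
    hamLin p X = hamMap n (Complex.imCLM.comp (fderiv ℝ (fderiv ℝ p) 0 X)) := rfl

theorem hamVec_im_quadApprox (hp : ContDiff ℝ ∞ p) :
    hamVec (fun Y => (quadApprox p Y).im) = hamLin p := by
  funext X
  rw [hamVec_eq, hamLin_apply]
  congr 1
  exact (Complex.imCLM.hasFDerivAt.comp X (hasFDerivAt_quadApprox hp X)).fderiv

theorem PrincipalSymbolAssumptions.norm_hamVec_im_sub_hamLin_le
    (hp : PrincipalSymbolAssumptions p T) {M : ℝ}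
    (hM : ∀ X, ‖iteratedFDeriv ℝ 3 p X‖ ≤ M) (X : Phase n) :
    ‖hamVec (fun Y => (p Y).im) X - hamLin p X‖ ≤ ‖hamMap n‖ * M * ‖X‖ ^ 2 := by
  rw [hamVec_im_eq hp.smooth, hamLin_apply, ← map_sub, ← ContinuousLinearMap.comp_sub, mul_assoc]
  refine ((hamMap n).le_opNorm _).trans ?_
  gcongr
  exact (norm_imCLM_comp_le _).trans
    (norm_fderiv_sub_quadApprox_le hp.smooth hM hp.fderiv_zero X)

/-- The Hamilton field of a quadratic form is linear, so its flow is a matrix exponential. -/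
theorem hamFlow_quadApprox (hp : ContDiff ℝ ∞ p) (t : ℝ) (X : Phase n) :
    hamFlow (fun Y => (quadApprox p Y).im) t X = NormedSpace.exp (t • hamLin p) X := by
  have h := hamVec_im_quadApprox hp
  refine hamFlow_eq (K := ‖hamLin p‖₊) (by rw [h]; exact (hamLin p).lipschitz)
    (γ := fun t => NormedSpace.exp (t • hamLin p) X) ⟨exp_zero_smul_apply _ X, fun t => ?_⟩ t
  rw [h]
  exact hasDerivAt_exp_smul_apply _ X t

/-- A continuous function that is homogeneous of degree two and positive off the origin is bounded
below by a multiple of the squared norm. -/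
theorem exists_le_of_homogeneous {E : Type*} [NormedAddCommGroup E] [NormedSpace ℝ E]
    [FiniteDimensional ℝ E] {g : E → ℝ} (hg : Continuous g)
    (hom : ∀ (s : ℝ) X, g (s • X) = s ^ 2 * g X) (hpos : ∀ X, X ≠ 0 → 0 < g X) :
    ∃ c : ℝ, 0 < c ∧ ∀ X, c * ‖X‖ ^ 2 ≤ g X := by
  have h0 : g 0 = 0 := by simpa using hom 0 0
  -- The sphere is empty when the space is trivial, as happens for `n = 0`.
  rcases (Metric.sphere (0 : E) 1).eq_empty_or_nonempty with he | hne
  · refine ⟨1, one_pos, fun X => ?_⟩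
    by_cases hX : X = 0
    · simp [hX, h0]
    · have : (‖X‖⁻¹ • X) ∈ Metric.sphere (0 : E) 1 := by
        simp [norm_smul, norm_ne_zero_iff.2 hX]
      simp [he] at this
  · obtain ⟨Z, hZ, hmin⟩ := (isCompact_sphere (0 : E) 1).exists_isMinOn hne hg.continuousOn
    have hZ1 : ‖Z‖ = 1 := by simpa using hZ
    refine ⟨g Z, hpos Z (by rintro rfl; simp at hZ1), fun X => ?_⟩
    by_cases hX : X = 0
    · simp [hX, h0]
    · have hX' : ‖X‖ ≠ 0 := norm_ne_zero_iff.2 hX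
      have h1 : g Z ≤ g (‖X‖⁻¹ • X) := hmin (by simp [norm_smul, hX'])
      rw [hom] at h1
      calc g Z * ‖X‖ ^ 2 ≤ (‖X‖⁻¹ ^ 2 * g X) * ‖X‖ ^ 2 := by gcongr
        _ = g X := by field_simp

theorem continuous_quadApprox (p : Phase n → ℂ) : Continuous (quadApprox p) := by
  rw [funext (quadApprox_eq p)]
  fun_prop

theorem continuous_exp_smul_apply (F : Phase n →L[ℝ] Phase n) :
    Continuous fun z : Phase n × ℝ => NormedSpace.exp (z.2 • F) z.1 := by
  have h : Continuous fun t : ℝ => NormedSpace.exp (t • F) :=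
    (differentiable_exp_smul_const ℝ F).continuous
  exact (h.comp continuous_snd).clm_apply continuous_fst

theorem PrincipalSymbolAssumptions.exists_quadratic_average_lower_bound
    (hp : PrincipalSymbolAssumptions p T) :
    ∃ c : ℝ, 0 < c ∧ ∀ X, c * ‖X‖ ^ 2 ≤
      flowAverage (fun Y => (quadApprox p Y).re) (fun Y => (quadApprox p Y).im) T X := by
  have hE : ∀ X, flowAverage (fun Y => (quadApprox p Y).re) (fun Y => (quadApprox p Y).im) T X =
      1 / (2 * T) * ∫ t in (-T)..T, (quadApprox p (NormedSpace.exp (t • hamLin p) X)).re :=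
    fun X => flowAverage_eq fun t => hamFlow_quadApprox hp.smooth t X
  refine exists_le_of_homogeneous ?_ (fun s X => ?_) hp.quadratic_average_pos
  · rw [funext hE]
    refine continuous_const.mul
      (intervalIntegral.continuous_parametric_intervalIntegral_of_continuous' ?_ _ _)
    exact Complex.continuous_re.comp ((continuous_quadApprox p).comp (continuous_exp_smul_apply _))
  · have : ∀ Y, quadApprox p (s • Y) = (s ^ 2 : ℝ) * quadApprox p Y := by
      intro Y
      simp only [quadApprox_eq, map_smul, smul_apply, Complex.real_smul]
      push_cast
      ring
    simp only [hE, map_smul, this, Complex.re_ofReal_mul, intervalIntegral.integral_const_mul]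
    ring

theorem norm_quadApprox_sub_le (p : Phase n → ℂ) (X Y : Phase n) :
    ‖quadApprox p X - quadApprox p Y‖ ≤
      ‖fderiv ℝ (fderiv ℝ p) 0‖ * (‖X‖ + ‖Y‖) * ‖X - Y‖ := by
  set B := fderiv ℝ (fderiv ℝ p) 0
  have h : quadApprox p X - quadApprox p Y = (1 / 2 : ℂ) * (B X (X - Y) + B (X - Y) Y) := by
    rw [quadApprox_eq, quadApprox_eq, map_sub, map_sub, sub_apply]
    ring
  have h1 : ‖B X (X - Y)‖ ≤ ‖B‖ * ‖X‖ * ‖X - Y‖ := B.le_opNorm₂ _ _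
  have h2 : ‖B (X - Y) Y‖ ≤ ‖B‖ * ‖X - Y‖ * ‖Y‖ := B.le_opNorm₂ _ _
  have h3 : 0 ≤ ‖B‖ * (‖X‖ + ‖Y‖) * ‖X - Y‖ := by positivity
  rw [h, norm_mul]
  have h4 := norm_add_le (B X (X - Y)) (B (X - Y) Y)
  have h5 : ‖(1 / 2 : ℂ)‖ = 1 / 2 := by norm_num
  rw [h5]
  nlinarith

theorem exists_hamCurve (hp : ContDiff ℝ ∞ p) {M₁ M₂ : ℝ} (hM₁ : ∀ X, ‖iteratedFDeriv ℝ 1 p X‖ ≤ M₁)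
    (hM₂ : ∀ X, ‖iteratedFDeriv ℝ 2 p X‖ ≤ M₂) (X : Phase n) :
    ∃ γ, IsHamCurve (fun Y => (p Y).im) X γ := by
  refine exists_integralCurve_of_bounded (lipschitzWith_hamVec_im hp hM₂)
    (M := ‖hamMap n‖ * M₁) (fun Y => ?_) X
  rw [hamVec_im_eq hp]
  refine ((hamMap n).le_opNorm _).trans ?_
  gcongr
  refine (norm_imCLM_comp_le _).trans ?_
  rw [← norm_iteratedFDeriv_one]
  exact hM₁ Y

/-- Near the origin the averages of `Re p` and of its quadratic approximation, each along its own
flow, differ by `O(|X|³)`, and a small radius lets the quadratic lower bound absorb this. -/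
theorem PrincipalSymbolAssumptions.exists_average_lower_bound
    (hp : PrincipalSymbolAssumptions p T) {M₁ M₂ M₃ : ℝ}
    (hM₁ : ∀ X, ‖iteratedFDeriv ℝ 1 p X‖ ≤ M₁) (hM₂ : ∀ X, ‖iteratedFDeriv ℝ 2 p X‖ ≤ M₂)
    (hM₃ : ∀ X, ‖iteratedFDeriv ℝ 3 p X‖ ≤ M₃) :
    ∃ c r : ℝ, 0 < c ∧ 0 < r ∧ ∀ X, ‖X‖ ≤ r →
      c * ‖X‖ ^ 2 ≤ flowAverage (fun Y => (p Y).re) (fun Y => (p Y).im) T X := by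
  have hT := hp.time_pos
  have hM₂0 : 0 ≤ M₂ := (norm_nonneg _).trans (hM₂ 0)
  have hM₃0 : 0 ≤ M₃ := (norm_nonneg _).trans (hM₃ 0)
  obtain ⟨c, hc, hcq⟩ := hp.exists_quadratic_average_lower_bound
  set v := hamVec (fun Y => (p Y).im)
  set K := ‖hamMap n‖ * M₂
  have hK : 0 ≤ K := by positivity
  have hvK : ∀ x, ‖v x‖ ≤ K * ‖x‖ := hp.norm_hamVec_im_le hM₂
  obtain ⟨C₁, hC₁, hC₁'⟩ := exists_norm_curve_sub_linear_le (F := hamLin p) (S := T) hT.le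
    (by positivity) hvK (hp.norm_hamVec_im_sub_hamLin_le hM₃) hK
  set A := Real.exp (K * T) with hA
  set A' := Real.exp (‖hamLin p‖ * T) with hA'
  set B := ‖fderiv ℝ (fderiv ℝ p) 0‖
  set C := M₃ * A ^ 3 + B * (A + A') * C₁ with hC
  have hC0 : 0 ≤ C := by positivity
  -- With this radius `(C + 1)‖X‖ ≤ c / 2`, so the cubic error uses up half of `c‖X‖²`; the `+ 1`
  -- keeps the denominator positive.
  refine ⟨c / 2, c / (2 * (C + 1)), by positivity, by positivity, fun X hX => ?_⟩
  obtain ⟨γ, hγ⟩ := exists_hamCurve hp.smooth hM₁ hM₂ X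
  set σ : ℝ → Phase n := fun t => NormedSpace.exp (t • hamLin p) X with hσ
  have hσ' : ∀ t, HasDerivAt σ (hamLin p (σ t)) t := hasDerivAt_exp_smul_apply _ X
  have hσ0 : σ 0 = X := exp_zero_smul_apply _ X
  have h1 : flowAverage (fun Y => (p Y).re) (fun Y => (p Y).im) T X =
      1 / (2 * T) * ∫ t in (-T)..T, (p (γ t)).re :=
    flowAverage_eq (hamFlow_eq (lipschitzWith_hamVec_im hp.smooth hM₂) hγ)
  have h2 : flowAverage (fun Y => (quadApprox p Y).re) (fun Y => (quadApprox p Y).im) T X =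
      1 / (2 * T) * ∫ t in (-T)..T, (quadApprox p (σ t)).re :=
    flowAverage_eq fun t => hamFlow_quadApprox hp.smooth t X
  have hγc : Continuous γ := continuous_iff_continuousAt.2 fun t => (hγ.2 t).continuousAt
  have hσc : Continuous σ := continuous_iff_continuousAt.2 fun t => (hσ' t).continuousAt
  have hpt : ∀ t ∈ Set.uIoc (-T) T,
      ‖(quadApprox p (σ t)).re - (p (γ t)).re‖ ≤ C * ‖X‖ ^ 3 := by
    intro t ht
    rw [Set.uIoc_of_le (by linarith)] at ht
    have htT : |t| ≤ T := abs_le.2 ⟨ht.1.le, ht.2⟩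
    have e1 : ‖γ t‖ ≤ A * ‖X‖ := by
      have := norm_curve_le hvK hγ.2 t
      rw [hγ.1] at this
      refine this.trans ?_
      rw [hA]
      gcongr
    have e2 : ‖σ t‖ ≤ A' * ‖X‖ := by
      have := norm_curve_le (v := hamLin p) (fun x => (hamLin p).le_opNorm x) hσ' t
      rw [hσ0] at this
      refine this.trans ?_
      rw [hA']
      gcongr
    have e3 : ‖γ t - σ t‖ ≤ C₁ * ‖X‖ ^ 2 := by
      have := hC₁' γ σ hγ.2 hσ' (by rw [hγ.1, hσ0]) t htT
      rwa [hγ.1] at this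
    have e4 := norm_sub_quadApprox_le hp.smooth hM₃ hp.map_zero hp.fderiv_zero (γ t)
    have e5 := norm_quadApprox_sub_le p (γ t) (σ t)
    rw [Real.norm_eq_abs, abs_sub_comm, ← Complex.sub_re]
    calc |(p (γ t) - quadApprox p (σ t)).re| ≤ ‖p (γ t) - quadApprox p (σ t)‖ :=
          Complex.abs_re_le_norm _
      _ ≤ ‖p (γ t) - quadApprox p (γ t)‖ + ‖quadApprox p (γ t) - quadApprox p (σ t)‖ :=
          norm_sub_le_norm_sub_add_norm_sub _ _ _
      _ ≤ M₃ * (A * ‖X‖) ^ 3 + B * (A * ‖X‖ + A' * ‖X‖) * (C₁ * ‖X‖ ^ 2) := by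
          refine add_le_add (e4.trans ?_) (e5.trans ?_) <;> gcongr
      _ = C * ‖X‖ ^ 3 := by rw [hC]; ring
  have hint := intervalIntegral.norm_integral_le_of_norm_le_const hpt
  rw [intervalIntegral.integral_sub] at hint
  · have hq := hcq X
    rw [h2] at hq
    rw [h1]
    have hle := (le_abs_self _).trans hint
    rw [abs_of_pos (by linarith : 0 < T - -T)] at hle
    have h3 : 1 / (2 * T) * (∫ t in (-T)..T, (quadApprox p (σ t)).re) - C * ‖X‖ ^ 3 ≤
        1 / (2 * T) * ∫ t in (-T)..T, (p (γ t)).re := by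
      have : 1 / (2 * T) * ((∫ t in (-T)..T, (quadApprox p (σ t)).re) -
          ∫ t in (-T)..T, (p (γ t)).re) ≤ 1 / (2 * T) * (C * ‖X‖ ^ 3 * (T - -T)) := by gcongr
      have h4 : 1 / (2 * T) * (C * ‖X‖ ^ 3 * (T - -T)) = C * ‖X‖ ^ 3 := by
        field_simp; ring
      linarith
    have h5 : (C + 1) * ‖X‖ ≤ c / 2 := by
      rw [le_div_iff₀ (by positivity)] at hX
      linarith
    have h6 : C * ‖X‖ ^ 3 ≤ c / 2 * ‖X‖ ^ 2 := by
      have : (C + 1) * ‖X‖ * ‖X‖ ^ 2 ≤ c / 2 * ‖X‖ ^ 2 := by gcongr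
      nlinarith [pow_nonneg (norm_nonneg X) 3]
    linarith
  · exact (Complex.continuous_re.comp ((continuous_quadApprox p).comp hσc)).intervalIntegrable _ _
  · exact (Complex.continuous_re.comp (hp.smooth.continuous.comp hγc)).intervalIntegrable _ _

/-- Along forward integral curves of `H_{Im p}` of length `2T` the integral of `Re p` controls the
squared norm of the initial point, locally uniformly. -/
theorem PrincipalSymbolAssumptions.exists_integral_curve_lower_bound
    (hp : PrincipalSymbolAssumptions p T) {M₁ M₂ M₃ : ℝ}
    (hM₁ : ∀ X, ‖iteratedFDeriv ℝ 1 p X‖ ≤ M₁) (hM₂ : ∀ X, ‖iteratedFDeriv ℝ 2 p X‖ ≤ M₂)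
    (hM₃ : ∀ X, ‖iteratedFDeriv ℝ 3 p X‖ ≤ M₃) (R : ℝ) :
    ∃ c : ℝ, 0 < c ∧ ∀ X γ, ‖X‖ ≤ R → IsHamCurve (fun Y => (p Y).im) X γ →
      c * ‖X‖ ^ 2 ≤ ∫ t in (0)..(2 * T), (p (γ t)).re := by
  have hT := hp.time_pos
  have hM₂0 : 0 ≤ M₂ := (norm_nonneg _).trans (hM₂ 0)
  obtain ⟨c, r, hc, hr, hcr⟩ := hp.exists_average_lower_bound hM₁ hM₂ hM₃
  obtain ⟨e, he, hed⟩ := hp.average_pos r hr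
  set K := ‖hamMap n‖ * M₂
  set A := Real.exp (K * T)
  have hA : 0 < A := Real.exp_pos _
  -- The two entries serve `‖γ T‖ ≤ r` and `‖γ T‖ > r`; `A` transfers norms from the midpoint `γ T`
  -- back to `X`, and `2T` undoes the normalization of the average.
  refine ⟨2 * T * min (c / A ^ 2) (e / (R ^ 2 + 1)), by positivity, fun X γ hX hγ => ?_⟩
  -- Centering the symmetric window at `γ T` turns it into the forward window `[0, 2T]` starting at
  -- `X`.
  have hshift : flowAverage (fun Y => (p Y).re) (fun Y => (p Y).im) T (γ T) =
      1 / (2 * T) * ∫ t in (0)..(2 * T), (p (γ t)).re := by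
    have hc' : IsHamCurve (fun Y => (p Y).im) (γ T) (fun t => γ (t + T)) :=
      ⟨by simp, fun t => (hγ.2 (t + T)).comp_add_const t T⟩
    rw [flowAverage_eq (hamFlow_eq (lipschitzWith_hamVec_im hp.smooth hM₂) hc'),
      intervalIntegral.integral_comp_add_right (fun t => (p (γ t)).re)]
    rw [neg_add_cancel, two_mul]
  have hXY : ‖X‖ ≤ A * ‖γ T‖ := by
    have := norm_zero_le_curve (hp.norm_hamVec_im_le hM₂) hγ.2 hT.le
    rwa [hγ.1] at this
  have key : min (c / A ^ 2) (e / (R ^ 2 + 1)) * ‖X‖ ^ 2 ≤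
      flowAverage (fun Y => (p Y).re) (fun Y => (p Y).im) T (γ T) := by
    rcases le_or_gt ‖γ T‖ r with h | h
    · refine le_trans ?_ (hcr _ h)
      calc _ ≤ c / A ^ 2 * (A * ‖γ T‖) ^ 2 := by
            gcongr
            exact min_le_left _ _
        _ = _ := by field_simp
    · refine le_trans ?_ (hed _ h).le
      have : ‖X‖ ^ 2 ≤ R ^ 2 + 1 := by nlinarith [norm_nonneg X]
      calc _ ≤ e / (R ^ 2 + 1) * (R ^ 2 + 1) := by
            gcongr
            exact min_le_right _ _
        _ = e := by field_simp
  rw [hshift, one_div, inv_mul_eq_div, le_div_iff₀ (by positivity)] at key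
  linarith

end Symbol

/-! ### The explicit Euler scheme and its errors. -/

section Euler

variable {E : Type*} [NormedAddCommGroup E] [NormedSpace ℝ E]

/-- The `j`-th iterate of the explicit Euler scheme with step `h` for the vector field `v`. -/
def euler (v : E → E) (h : ℝ) : ℕ → E → E
  | 0, x => x
  | j + 1, x => euler v h j x + h • v (euler v h j x)

theorem contDiff_euler {v : E → E} (hv : ContDiff ℝ ∞ v) (h : ℝ) (j : ℕ) :
    ContDiff ℝ ∞ (euler v h j) := by
  induction j with
  | zero => exact contDiff_id
  | succ j ih => exact ih.add (contDiff_const.smul (hv.comp ih))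

theorem discrete_gronwall_le {e : ℕ → ℝ} {K h d S : ℝ} (hK : 0 ≤ K) (hh : 0 ≤ h) (hd : 0 ≤ d)
    (h0 : e 0 ≤ 0) {N : ℕ} (he : ∀ j < N, e (j + 1) ≤ (1 + h * K) * e j + h * d) (hN : N * h ≤ S) :
    ∀ j ≤ N, e j ≤ S * d * Real.exp (K * S) := by
  have hS : 0 ≤ S := le_trans (by positivity) hN
  have key : ∀ j ≤ N, e j ≤ j * h * d * Real.exp (K * (j * h)) := by
    intro j
    induction j with
    | zero => intro _; simpa using h0
    | succ j ih =>
      intro hj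
      have h1 : 1 + h * K ≤ Real.exp (K * h) := by
        have := Real.add_one_le_exp (K * h); linarith
      have h2 : 1 ≤ Real.exp (K * ((j + 1 : ℕ) * h)) := Real.one_le_exp (by positivity)
      have h3 : Real.exp (K * ((j + 1 : ℕ) * h)) = Real.exp (K * h) * Real.exp (K * (j * h)) := by
        rw [← Real.exp_add]; push_cast; ring_nf
      calc e (j + 1) ≤ (1 + h * K) * e j + h * d := he j (by omega)
        _ ≤ (1 + h * K) * (j * h * d * Real.exp (K * (j * h))) + h * d * 1 := by
            rw [mul_one]
            gcongr
            exact ih (by omega)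
        _ ≤ Real.exp (K * h) * (j * h * d * Real.exp (K * (j * h))) +
              h * d * Real.exp (K * ((j + 1 : ℕ) * h)) := by gcongr
        _ = _ := by rw [h3]; push_cast; ring
  intro j hj
  have hjS : j * h ≤ S := (by gcongr : (j : ℝ) * h ≤ N * h).trans hN
  refine (key j hj).trans ?_
  gcongr

theorem norm_euler_le {v : E → E} {K h S : ℝ} (hK : 0 ≤ K) (hh : 0 ≤ h)
    (hv : ∀ x, ‖v x‖ ≤ K * ‖x‖) {j : ℕ} (hj : j * h ≤ S) (x : E) :
    ‖euler v h j x‖ ≤ Real.exp (K * S) * ‖x‖ := by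
  have key : ∀ j : ℕ, ‖euler v h j x‖ ≤ Real.exp (K * (j * h)) * ‖x‖ := by
    intro j
    induction j with
    | zero => simp [euler]
    | succ j ih =>
      have h1 : 1 + h * K ≤ Real.exp (K * h) := by
        have := Real.add_one_le_exp (K * h); linarith
      have h3 : Real.exp (K * ((j + 1 : ℕ) * h)) = Real.exp (K * h) * Real.exp (K * (j * h)) := by
        rw [← Real.exp_add]; push_cast; ring_nf
      calc ‖euler v h (j + 1) x‖ ≤ ‖euler v h j x‖ + ‖h • v (euler v h j x)‖ := norm_add_le _ _
        _ ≤ ‖euler v h j x‖ + h * (K * ‖euler v h j x‖) := by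
            rw [norm_smul, Real.norm_of_nonneg hh]
            gcongr
            exact hv _
        _ = (1 + h * K) * ‖euler v h j x‖ := by ring
        _ ≤ Real.exp (K * h) * (Real.exp (K * (j * h)) * ‖x‖) := by gcongr
        _ = _ := by rw [h3]; ring
  refine (key j).trans ?_
  gcongr

/-- One step shrinks norms by at most the factor `1 - hK`, and `(1 + 2hK)(1 - hK) ≥ 1` exactly
because `hK ≤ 1/2`. This makes the weights at the start and along the scheme comparable. -/
theorem norm_le_norm_euler {v : E → E} {K h S : ℝ} (hK : 0 ≤ K) (hh : 0 ≤ h) (hhK : h * K ≤ 1 / 2)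
    (hv : ∀ x, ‖v x‖ ≤ K * ‖x‖) {j : ℕ} (hj : j * h ≤ S) (x : E) :
    ‖x‖ ≤ Real.exp (2 * K * S) * ‖euler v h j x‖ := by
  have key : ∀ j : ℕ, ‖x‖ ≤ Real.exp (2 * K * (j * h)) * ‖euler v h j x‖ := by
    intro j
    induction j with
    | zero => simp [euler]
    | succ j ih =>
      have h1 : 1 + 2 * (h * K) ≤ Real.exp (2 * K * h) := by
        have := Real.add_one_le_exp (2 * K * h); linarith
      have h3 : Real.exp (2 * K * ((j + 1 : ℕ) * h)) =
          Real.exp (2 * K * (j * h)) * Real.exp (2 * K * h) := by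
        rw [← Real.exp_add]; push_cast; ring_nf
      have h4 : ‖euler v h j x‖ ≤ ‖euler v h (j + 1) x‖ + h * (K * ‖euler v h j x‖) := by
        have e1 : euler v h j x = euler v h (j + 1) x - h • v (euler v h j x) := by
          simp [euler]
        calc ‖euler v h j x‖ ≤ ‖euler v h (j + 1) x‖ + ‖h • v (euler v h j x)‖ := by
              conv_lhs => rw [e1]
              exact norm_sub_le _ _
          _ ≤ _ := by
              rw [norm_smul, Real.norm_of_nonneg hh]
              gcongr
              exact hv _
      have h5 : ‖euler v h j x‖ ≤ (1 + 2 * (h * K)) * ‖euler v h (j + 1) x‖ := by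
        have h6 : 0 ≤ h * K := by positivity
        have h7 : (1 + 2 * (h * K)) * ((1 - h * K) * ‖euler v h j x‖) ≤
            (1 + 2 * (h * K)) * ‖euler v h (j + 1) x‖ := by gcongr; linarith
        have h8 : 1 * ‖euler v h j x‖ ≤ ((1 + 2 * (h * K)) * (1 - h * K)) * ‖euler v h j x‖ := by
          gcongr
          nlinarith
        linarith
      calc ‖x‖ ≤ Real.exp (2 * K * (j * h)) * ‖euler v h j x‖ := ih
        _ ≤ Real.exp (2 * K * (j * h)) *
            (Real.exp (2 * K * h) * ‖euler v h (j + 1) x‖) := by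
              gcongr
              exact h5.trans (by gcongr)
        _ = _ := by rw [h3]; ring
  refine (key j).trans ?_
  gcongr

theorem norm_curve_sub_le {v : E → E} {K S : ℝ} (hK : 0 ≤ K) (hv : ∀ x, ‖v x‖ ≤ K * ‖x‖)
    {γ : ℝ → E} (hγ : ∀ t, HasDerivAt γ (v (γ t)) t) {s t : ℝ} (hs : s ∈ Set.Icc 0 S)
    (ht : t ∈ Set.Icc 0 S) :
    ‖γ t - γ s‖ ≤ K * Real.exp (K * S) * ‖γ 0‖ * |t - s| := by
  refine (convex_Icc (0 : ℝ) S).norm_image_sub_le_of_norm_hasDerivWithin_le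
    (fun r _ => (hγ r).hasDerivWithinAt) (fun r hr => ?_) hs ht
  rw [mul_assoc]
  refine (hv _).trans ?_
  gcongr
  refine (norm_curve_le_of_nonneg hv hγ hr.1).trans ?_
  gcongr
  exact hr.2

open scoped NNReal in
/-- Convergence of order one of the Euler scheme. -/
theorem norm_euler_sub_curve_le {v : E → E} {K : ℝ≥0} {S h : ℝ} (hh : 0 ≤ h)
    (hv : ∀ x, ‖v x‖ ≤ K * ‖x‖) (hL : LipschitzWith K v)
    {γ : ℝ → E} (hγ : ∀ t, HasDerivAt γ (v (γ t)) t) {N : ℕ} (hN : N * h ≤ S) :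
    ∀ j ≤ N, ‖euler v h j (γ 0) - γ (j * h)‖ ≤
      S * (h * (K * (K * Real.exp (K * S) * ‖γ 0‖))) * Real.exp (K * S) := by
  have hLv : ∀ x y, ‖v x - v y‖ ≤ K * ‖x - y‖ := fun x y => by
    simpa [dist_eq_norm] using hL.dist_le_mul x y
  refine discrete_gronwall_le (e := fun j => ‖euler v h j (γ 0) - γ (j * h)‖) K.coe_nonneg hh
    (by positivity) (by simp [euler]) (fun j hj => ?_) hN
  set t : ℝ := j * h with ht
  have hjN : ((j + 1 : ℕ) : ℝ) * h ≤ S := le_trans (by gcongr; omega) hN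
  have ht' : ((j + 1 : ℕ) : ℝ) * h = t + h := by push_cast; rw [ht]; ring
  rw [ht'] at hjN ⊢
  have ht0 : 0 ≤ t := by positivity
  -- Local truncation error `O(h²)`; the discrete Grönwall inequality sums `O(1/h)` of these to
  -- `O(h)`.
  have hloc : ‖γ (t + h) - γ t - h • v (γ t)‖ ≤
      (K * (K * Real.exp (K * S) * ‖γ 0‖ * h)) * h := by
    have h1 := (convex_Icc t (t + h)).norm_image_sub_le_of_norm_hasDerivWithin_le
      (f := fun s => γ s - (s - t) • v (γ t)) (f' := fun s => v (γ s) - (1 : ℝ) • v (γ t))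
      (C := K * (K * Real.exp (K * S) * ‖γ 0‖ * h))
      (fun r _ => ((hγ r).sub
        (((hasDerivAt_id r).sub_const t).smul_const (v (γ t)))).hasDerivWithinAt)
      (fun r hr => ?_) (Set.left_mem_Icc.2 (by linarith)) (Set.right_mem_Icc.2 (by linarith))
    · simp only [sub_self, zero_smul, sub_zero, add_sub_cancel_left, Real.norm_of_nonneg hh] at h1
      rwa [sub_right_comm] at h1
    · rw [one_smul]
      refine (hLv _ _).trans ?_
      gcongr
      refine (norm_curve_sub_le K.coe_nonneg hv hγ (s := t) (t := r) (S := S) ⟨ht0, by linarith⟩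
        ⟨by linarith [hr.1], by linarith [hr.2]⟩).trans ?_
      gcongr
      rw [abs_of_nonneg (by linarith [hr.1])]
      linarith [hr.2]
  set x := euler v h j (γ 0) with hx
  have hsplit : euler v h (j + 1) (γ 0) - γ (t + h) =
      (x - γ t) + h • (v x - v (γ t)) - (γ (t + h) - γ t - h • v (γ t)) := by
    simp only [euler, ← hx, smul_sub]
    abel
  rw [hsplit]
  have h2 : ‖h • (v x - v (γ t))‖ ≤ h * (K * ‖x - γ t‖) := by
    rw [norm_smul, Real.norm_of_nonneg hh]
    gcongr
    exact hLv _ _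
  have h3 := norm_sub_le ((x - γ t) + h • (v x - v (γ t))) (γ (t + h) - γ t - h • v (γ t))
  have h4 := norm_add_le (x - γ t) (h • (v x - v (γ t)))
  nlinarith

open scoped NNReal in
/-- Riemann sums along the Euler scheme approximate integrals along integral curves. -/
theorem exists_euler_sum_sub_integral_le {v : E → E} {K : ℝ≥0} {S M : ℝ} (hS : 0 < S)
    (hv : ∀ x, ‖v x‖ ≤ K * ‖x‖) (hL : LipschitzWith K v) {a : E → ℝ} (hac : Continuous a)
    (hM : 0 ≤ M) (ha : ∀ x y, |a x - a y| ≤ M * (‖x‖ + ‖y‖) * ‖x - y‖) :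
    ∃ C : ℝ, 0 ≤ C ∧ ∀ N : ℕ, 0 < N → ∀ γ : ℝ → E, (∀ t, HasDerivAt γ (v (γ t)) t) →
      |S / N * ∑ j ∈ Finset.range N, a (euler v (S / N) (j + 1) (γ 0)) - ∫ t in (0)..S, a (γ t)| ≤
        C * (S / N) * ‖γ 0‖ ^ 2 := by
  set A := Real.exp (K * S) with hA
  -- First summand: global error of the scheme at a node. Second: motion of the exact curve within
  -- one step.
  set D := S * (K * (K * A)) * A + K * A with hD
  refine ⟨M * (A + A) * D * S, by positivity, fun N hN γ hγ => ?_⟩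
  have hN' : (0 : ℝ) < N := by exact_mod_cast hN
  set h := S / N with hh
  have hh0 : 0 < h := by positivity
  have hNh : N * h = S := by rw [hh]; field_simp
  have hγc : Continuous γ := continuous_iff_continuousAt.2 fun t => (hγ t).continuousAt
  have hint : ∫ t in (0)..S, a (γ t) =
      ∑ j ∈ Finset.range N, ∫ t in (j * h)..((j + 1 : ℕ) * h), a (γ t) := by
    rw [intervalIntegral.sum_integral_adjacent_intervals (f := fun t => a (γ t))
      (μ := MeasureTheory.volume) (a := fun j : ℕ => (j : ℝ) * h) (fun k _ => (hac.comp hγc).intervalIntegrable _ _)]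
    simp [hNh]
  rw [hint, Finset.mul_sum, ← Finset.sum_sub_distrib]
  have hterm : ∀ j ∈ Finset.range N,
      |h * a (euler v h (j + 1) (γ 0)) - ∫ t in (j * h)..((j + 1 : ℕ) * h), a (γ t)| ≤
        M * (A + A) * D * h * ‖γ 0‖ ^ 2 * h := by
    intro j hj
    have hjN : j + 1 ≤ N := Finset.mem_range.1 hj
    have hlen : ((j + 1 : ℕ) : ℝ) * h - j * h = h := by push_cast; ring
    have hle : ((j + 1 : ℕ) : ℝ) * h ≤ S := by
      rw [← hNh]
      exact mul_le_mul_of_nonneg_right (by exact_mod_cast hjN) hh0.le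
    have e0 : h * a (euler v h (j + 1) (γ 0)) =
        ∫ _t in (j * h)..((j + 1 : ℕ) * h), a (euler v h (j + 1) (γ 0)) := by
      rw [intervalIntegral.integral_const, hlen, smul_eq_mul]
    rw [e0, ← intervalIntegral.integral_sub (g := fun t => a (γ t))
      (continuous_const.intervalIntegrable _ _) ((hac.comp hγc).intervalIntegrable _ _)]
    have := intervalIntegral.norm_integral_le_of_norm_le_const (a := j * h)
      (b := ((j + 1 : ℕ) : ℝ) * h) (C := M * (A + A) * D * h * ‖γ 0‖ ^ 2)
      (f := fun t => a (euler v h (j + 1) (γ 0)) - a (γ t)) (fun t ht => ?_)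
    · rwa [hlen, abs_of_pos hh0, Real.norm_eq_abs] at this
    · rw [Set.uIoc_of_le (by linarith)] at ht
      have ht0 : 0 ≤ t := le_trans (by positivity) ht.1.le
      have htS : t ≤ S := ht.2.trans hle
      have e1 : ‖euler v h (j + 1) (γ 0)‖ ≤ A * ‖γ 0‖ := norm_euler_le K.coe_nonneg hh0.le hv hle _
      have e2 : ‖γ t‖ ≤ A * ‖γ 0‖ := by
        refine (norm_curve_le_of_nonneg hv hγ ht0).trans ?_
        rw [hA]; gcongr
      have e3 := norm_euler_sub_curve_le hh0.le hv hL hγ hNh.le (j + 1) hjN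
      have e4 : ‖γ ((j + 1 : ℕ) * h) - γ t‖ ≤ K * A * ‖γ 0‖ * h := by
        refine (norm_curve_sub_le K.coe_nonneg hv hγ (s := t) (S := S) ⟨ht0, htS⟩
          ⟨by positivity, hle⟩).trans ?_
        gcongr
        rw [abs_of_nonneg (by linarith [ht.2])]
        linarith [ht.1]
      have e5 : ‖euler v h (j + 1) (γ 0) - γ t‖ ≤ D * h * ‖γ 0‖ := by
        refine (norm_sub_le_norm_sub_add_norm_sub _ (γ ((j + 1 : ℕ) * h)) _).trans
          ((add_le_add e3 e4).trans_eq ?_)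
        rw [hD, hA]; ring
      rw [Real.norm_eq_abs]
      calc _ ≤ M * (‖euler v h (j + 1) (γ 0)‖ + ‖γ t‖) * ‖euler v h (j + 1) (γ 0) - γ t‖ := ha _ _
        _ ≤ M * (A * ‖γ 0‖ + A * ‖γ 0‖) * (D * h * ‖γ 0‖) := by gcongr
        _ = _ := by ring
  refine (Finset.abs_sum_le_sum_abs _ _).trans ((Finset.sum_le_sum hterm).trans_eq ?_)
  rw [Finset.sum_const, Finset.card_range, nsmul_eq_mul, ← hNh]
  ring

theorem fderiv_euler_succ {v : E → E} (hv : ContDiff ℝ ∞ v) (h : ℝ) (j : ℕ) (x : E) :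
    fderiv ℝ (euler v h (j + 1)) x = fderiv ℝ (euler v h j) x +
      h • (fderiv ℝ v (euler v h j x)).comp (fderiv ℝ (euler v h j) x) := by
  have h1 := ((contDiff_euler hv h j).differentiable (by simp) x).hasFDerivAt
  have h2 := (hv.differentiable (by simp) (euler v h j x)).hasFDerivAt
  exact (h1.add ((h2.comp x h1).const_smul h)).fderiv

open scoped NNReal in
theorem norm_fderiv_euler_le {v : E → E} {K : ℝ≥0} {S h : ℝ} (hh : 0 ≤ h)
    (hvs : ContDiff ℝ ∞ v) (hL : LipschitzWith K v) {j : ℕ} (hj : j * h ≤ S) (x : E) :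
    ‖fderiv ℝ (euler v h j) x‖ ≤ Real.exp (K * S) := by
  have key : ∀ j : ℕ, ‖fderiv ℝ (euler v h j) x‖ ≤ Real.exp (K * (j * h)) := by
    intro j
    induction j with
    | zero =>
      have : euler v h 0 = id := rfl
      rw [this, fderiv_id]
      simpa using ContinuousLinearMap.norm_id_le (𝕜 := ℝ) (E := E)
    | succ j ih =>
      have h1 : 1 + h * K ≤ Real.exp (K * h) := by
        have := Real.add_one_le_exp (K * h); linarith
      have h3 : Real.exp (K * ((j + 1 : ℕ) * h)) = Real.exp (K * h) * Real.exp (K * (j * h)) := by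
        rw [← Real.exp_add]; push_cast; ring_nf
      rw [fderiv_euler_succ hvs]
      refine (norm_add_le _ _).trans ?_
      rw [norm_smul, Real.norm_of_nonneg hh]
      have h4 := (fderiv ℝ v (euler v h j x)).opNorm_comp_le (fderiv ℝ (euler v h j) x)
      have h5 : ‖fderiv ℝ v (euler v h j x)‖ ≤ K := norm_fderiv_le_of_lipschitz ℝ hL
      calc _ ≤ ‖fderiv ℝ (euler v h j) x‖ + h * (K * ‖fderiv ℝ (euler v h j) x‖) := by
            gcongr
            exact h4.trans (by gcongr)
        _ = (1 + h * K) * ‖fderiv ℝ (euler v h j) x‖ := by ring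
        _ ≤ Real.exp (K * h) * Real.exp (K * (j * h)) := by gcongr
        _ = _ := h3.symm
  refine (key j).trans ?_
  gcongr

open scoped NNReal in
/-- The differential of the Euler scheme transports the vector field up to an error of first
order in the step. -/
theorem norm_fderiv_euler_apply_sub_le {v : E → E} {K : ℝ≥0} {S h M : ℝ} (hh : 0 ≤ h)
    (hvs : ContDiff ℝ ∞ v) (hv : ∀ x, ‖v x‖ ≤ K * ‖x‖) (hL : LipschitzWith K v)
    (hM : ∀ x, ‖iteratedFDeriv ℝ 2 v x‖ ≤ M) {N : ℕ} (hN : N * h ≤ S) (x : E) :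
    ∀ j ≤ N, ‖fderiv ℝ (euler v h j) x (v x) - v (euler v h j x)‖ ≤
      S * (h * (M * (K * (Real.exp (K * S) * ‖x‖)) ^ 2)) * Real.exp (K * S) := by
  have hM0 : 0 ≤ M := (norm_nonneg _).trans (hM 0)
  refine discrete_gronwall_le
    (e := fun j => ‖fderiv ℝ (euler v h j) x (v x) - v (euler v h j x)‖) K.coe_nonneg hh
    (by positivity) ?_ (fun j hj => ?_) hN
  · have : euler v h 0 = id := rfl
    simp [this]
  · have hjS : j * h ≤ S := le_trans (by gcongr) hN
    set y := euler v h j x with hy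
    set w := fderiv ℝ (euler v h j) x (v x) with hw
    -- The only new error per step: the differential `1 + h Dv(y)` sends `v y` to the first-order
    -- expansion of `v` at the next node, so the defect `r` is `O(h²)`.
    set r := v (y + h • v y) - v y - fderiv ℝ v y (h • v y) with hr
    have hrle : ‖r‖ ≤ M * (h * (K * (Real.exp (K * S) * ‖x‖))) ^ 2 := by
      have := norm_taylor_one_le hvs hM y (y + h • v y)
      rw [add_sub_cancel_left, norm_smul, Real.norm_of_nonneg hh] at this
      refine this.trans ?_
      gcongr
      refine (hv y).trans ?_
      gcongr
      exact norm_euler_le K.coe_nonneg hh hv hjS x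
    have hsplit : fderiv ℝ (euler v h (j + 1)) x (v x) - v (euler v h (j + 1) x) =
        (w - v y) + h • fderiv ℝ v y (w - v y) - r := by
      rw [fderiv_euler_succ hvs]
      simp only [add_apply, smul_apply, ContinuousLinearMap.comp_apply, ← hw, ← hy, euler, hr,
        map_smul, map_sub, smul_sub]
      abel
    rw [hsplit]
    have h1 : ‖fderiv ℝ v y (w - v y)‖ ≤ K * ‖w - v y‖ :=
      ((fderiv ℝ v y).le_opNorm _).trans (by gcongr; exact norm_fderiv_le_of_lipschitz ℝ hL)
    have h2 := norm_sub_le ((w - v y) + h • fderiv ℝ v y (w - v y)) r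
    have h3 := norm_add_le (w - v y) (h • fderiv ℝ v y (w - v y))
    rw [norm_smul, Real.norm_of_nonneg hh] at h3
    have h4 : h * ‖fderiv ℝ v y (w - v y)‖ ≤ h * (K * ‖w - v y‖) := by gcongr
    nlinarith

end Euler

theorem two_le_infty : (2 : WithTop ℕ∞) ≤ ∞ := by
  simpa using WithTop.coe_le_coe.2 (le_top : (2 : ℕ∞) ≤ ⊤)

/-! ### The truncation `εa/(ε + |x|²)` and its derivatives. -/

section Weight

variable {E : Type*} [NormedAddCommGroup E]

/-- The weight `1 / (ε + |x|²)`. -/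
noncomputable def weight (ε : ℝ) (x : E) : ℝ := (ε + ‖x‖ ^ 2)⁻¹

theorem weight_pos {ε : ℝ} (hε : 0 < ε) (x : E) : 0 < weight ε x := by
  unfold weight; positivity

theorem mul_weight_le_one {ε : ℝ} (hε : 0 < ε) (x : E) : ε * weight ε x ≤ 1 := by
  unfold weight
  rw [← div_eq_mul_inv, div_le_one (by positivity)]
  nlinarith [norm_nonneg x]

theorem sq_mul_weight_le_one {ε : ℝ} (hε : 0 < ε) (x : E) : ‖x‖ ^ 2 * weight ε x ≤ 1 := by
  unfold weight
  rw [← div_eq_mul_inv, div_le_one (by positivity)]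
  linarith

theorem weight_le_of_norm_le {ε B : ℝ} (hε : 0 < ε) (hB : 1 ≤ B) {x y : E}
    (h : ‖x‖ ≤ B * ‖y‖) : weight ε y ≤ B ^ 2 * weight ε x := by
  have h1 : ε + ‖x‖ ^ 2 ≤ B ^ 2 * (ε + ‖y‖ ^ 2) := by
    have h2 : ‖x‖ ^ 2 ≤ (B * ‖y‖) ^ 2 := by gcongr
    nlinarith [mul_le_mul_of_nonneg_right (one_le_pow₀ hB : 1 ≤ B ^ 2) hε.le]
  unfold weight
  rw [← div_eq_mul_inv, le_div_iff₀ (by positivity), inv_mul_le_iff₀ (by positivity)]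
  linarith

/-- The truncation `ε a(x) / (ε + |x|²)` of a function `a`. -/
noncomputable def truncation (a : E → ℝ) (ε : ℝ) (x : E) : ℝ := ε * (a x * weight ε x)

variable {a : E → ℝ} {M : ℝ}

theorem truncation_le (ha : ∀ x, 0 ≤ a x) {ε : ℝ} (hε : 0 < ε) (x : E) :
    truncation a ε x ≤ a x := by
  have := mul_le_mul_of_nonneg_left (mul_weight_le_one hε x) (ha x)
  unfold truncation
  linarith

theorem abs_truncation_le (hM : 0 ≤ M) (h0 : ∀ x, |a x| ≤ M * ‖x‖ ^ 2) {ε : ℝ} (hε : 0 < ε)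
    (x : E) : |truncation a ε x| ≤ M * ε := by
  have hw := weight_pos hε x
  rw [truncation, abs_mul, abs_mul, abs_of_pos hε, abs_of_pos hw]
  calc ε * (|a x| * weight ε x) ≤ ε * (M * ‖x‖ ^ 2 * weight ε x) := by gcongr; exact h0 x
    _ = ε * (M * (‖x‖ ^ 2 * weight ε x)) := by ring
    _ ≤ ε * (M * 1) := by gcongr; exact sq_mul_weight_le_one hε x
    _ = _ := by ring

variable [InnerProductSpace ℝ E]

theorem contDiff_weight {ε : ℝ} (hε : 0 < ε) : ContDiff ℝ ∞ (weight ε : E → ℝ) := by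
  unfold weight
  exact (contDiff_const.add (contDiff_norm_sq ℝ)).inv fun x => by positivity

theorem hasFDerivAt_weight {ε : ℝ} (hε : 0 < ε) (x : E) :
    HasFDerivAt (weight ε : E → ℝ)
      ((weight ε x * weight ε x) • ((-2 : ℝ) • innerSL ℝ) x) x := by
  have h1 : HasFDerivAt (fun x : E => ε + ‖x‖ ^ 2) (2 • innerSL ℝ x) x :=
    (hasStrictFDerivAt_norm_sq x).hasFDerivAt.const_add ε
  have h2 := (hasDerivAt_inv (by positivity : ε + ‖x‖ ^ 2 ≠ 0)).comp_hasFDerivAt x h1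
  refine h2.congr_fderiv ?_
  ext y
  simp only [smul_apply, weight, smul_eq_mul, nsmul_eq_mul]
  field_simp
  simp [mul_comm]

theorem norm_fderiv_weight_le {ε : ℝ} (hε : 0 < ε) (x : E) :
    ‖fderiv ℝ (weight ε : E → ℝ) x‖ ≤ 2 * ‖x‖ * weight ε x ^ 2 := by
  rw [(hasFDerivAt_weight hε x).fderiv, norm_smul, smul_apply, norm_smul,
    innerSL_apply_norm, Real.norm_of_nonneg (mul_self_nonneg _)]
  norm_num
  linarith

theorem norm_iteratedFDeriv_two_weight_le {ε : ℝ} (hε : 0 < ε) (x : E) :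
    ‖iteratedFDeriv ℝ 2 (weight ε : E → ℝ) x‖ ≤ 10 * weight ε x ^ 2 := by
  have hw := weight_pos hε x
  have h0 : fderiv ℝ (weight ε : E → ℝ) =
      fun x => (weight ε x * weight ε x) • ((-2 : ℝ) • innerSL ℝ) x :=
    funext fun x => (hasFDerivAt_weight hε x).fderiv
  have hd : HasFDerivAt (weight ε : E → ℝ) (fderiv ℝ (weight ε) x) x :=
    ((contDiff_weight hε).differentiable (by simp) x).hasFDerivAt
  have h1 := (hd.mul hd).smul ((-2 : ℝ) • innerSL ℝ : E →L[ℝ] E →L[ℝ] ℝ).hasFDerivAt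
  rw [← norm_fderiv_fderiv, h0]
  refine (congrArg norm h1.fderiv).trans_le ?_
  have hLx : ∀ x : E, ‖((-2 : ℝ) • innerSL ℝ : E →L[ℝ] E →L[ℝ] ℝ) x‖ ≤ 2 * ‖x‖ := fun x => by
    rw [smul_apply, norm_smul, innerSL_apply_norm]
    norm_num
  have hL : ‖((-2 : ℝ) • innerSL ℝ : E →L[ℝ] E →L[ℝ] ℝ)‖ ≤ 2 :=
    ContinuousLinearMap.opNorm_le_bound _ (by norm_num) hLx
  have h2 := norm_fderiv_weight_le hε x
  have h3 := sq_mul_weight_le_one hε x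
  refine (norm_add_le _ _).trans ?_
  rw [norm_smul, ContinuousLinearMap.norm_smulRight_apply, Pi.mul_apply,
    Real.norm_of_nonneg (by positivity)]
  have h4 : ‖weight ε x • fderiv ℝ (weight ε) x + weight ε x • fderiv ℝ (weight ε) x‖ ≤
      2 * (weight ε x * (2 * ‖x‖ * weight ε x ^ 2)) := by
    refine (norm_add_le _ _).trans ?_
    rw [norm_smul, Real.norm_of_nonneg hw.le, ← two_mul]
    gcongr
  calc _ ≤ weight ε x * weight ε x * 2 +
        2 * (weight ε x * (2 * ‖x‖ * weight ε x ^ 2)) * (2 * ‖x‖) := by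
        gcongr
        exact hLx x
    _ = 2 * weight ε x ^ 2 + 8 * weight ε x ^ 2 * (‖x‖ ^ 2 * weight ε x) := by ring
    _ ≤ 2 * weight ε x ^ 2 + 8 * weight ε x ^ 2 * 1 := by gcongr
    _ = _ := by ring

theorem contDiff_truncation (ha : ContDiff ℝ ∞ a) {ε : ℝ} (hε : 0 < ε) :
    ContDiff ℝ ∞ (truncation a ε) :=
  contDiff_const.mul (ha.mul (contDiff_weight hε))

/-- The factors `‖x‖` and `weight ε x` are kept because the square of `ε‖x‖ weight ε x` is `ε‖x‖²
weight ε x` times a number at most 1, which is the gradient bound an escape function needs. -/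
theorem norm_fderiv_truncation_le (ha : ContDiff ℝ ∞ a) (hM : 0 ≤ M)
    (h0 : ∀ x, |a x| ≤ M * ‖x‖ ^ 2) (h1 : ∀ x, ‖fderiv ℝ a x‖ ≤ M * ‖x‖) {ε : ℝ} (hε : 0 < ε)
    (x : E) : ‖fderiv ℝ (truncation a ε) x‖ ≤ 3 * M * (ε * ‖x‖ * weight ε x) := by
  have hw := weight_pos hε x
  have hda : HasFDerivAt a (fderiv ℝ a x) x := (ha.differentiable (by simp) x).hasFDerivAt
  have hdw : HasFDerivAt (weight ε : E → ℝ) (fderiv ℝ (weight ε) x) x :=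
    ((contDiff_weight hε).differentiable (by simp) x).hasFDerivAt
  have h := ((hda.mul hdw).const_mul ε).fderiv
  have h' : fderiv ℝ (truncation a ε) x =
    ε • (a x • fderiv ℝ (weight ε) x + weight ε x • fderiv ℝ a x) := h
  rw [h', norm_smul, Real.norm_of_nonneg hε.le]
  have h2 := norm_fderiv_weight_le hε x
  have h3 := sq_mul_weight_le_one hε x
  calc _ ≤ ε * (|a x| * ‖fderiv ℝ (weight ε) x‖ + weight ε x * ‖fderiv ℝ a x‖) := by
        gcongr
        refine (norm_add_le _ _).trans ?_
        rw [norm_smul, norm_smul, Real.norm_of_nonneg hw.le, Real.norm_eq_abs]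
    _ ≤ ε * (M * ‖x‖ ^ 2 * (2 * ‖x‖ * weight ε x ^ 2) + weight ε x * (M * ‖x‖)) := by
        gcongr
        · exact h0 x
        · exact h1 x
    _ = ε * M * ‖x‖ * weight ε x * (2 * (‖x‖ ^ 2 * weight ε x) + 1) := by ring
    _ ≤ ε * M * ‖x‖ * weight ε x * (2 * 1 + 1) := by gcongr
    _ = _ := by ring

theorem norm_iteratedFDeriv_two_truncation_le (ha : ContDiff ℝ ∞ a) (hM : 0 ≤ M)
    (h0 : ∀ x, |a x| ≤ M * ‖x‖ ^ 2) (h1 : ∀ x, ‖fderiv ℝ a x‖ ≤ M * ‖x‖)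
    (h2 : ∀ x, ‖iteratedFDeriv ℝ 2 a x‖ ≤ M) {ε : ℝ} (hε : 0 < ε)
    (x : E) : ‖iteratedFDeriv ℝ 2 (truncation a ε) x‖ ≤ 15 * M * (ε * weight ε x) := by
  have hw := weight_pos hε x
  have hs : truncation a ε = ε • fun x => a x * weight ε x := rfl
  rw [hs, iteratedFDeriv_const_smul_apply
    ((ha.mul (contDiff_weight hε)).contDiffAt.of_le two_le_infty),
    norm_smul, Real.norm_of_nonneg hε.le]
  have h := norm_iteratedFDeriv_mul_le (N := ∞) ha (contDiff_weight hε) x (n := 2)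
    two_le_infty
  simp only [Finset.sum_range_succ, Finset.range_zero, Finset.sum_empty,
    norm_iteratedFDeriv_zero, norm_iteratedFDeriv_one, Nat.sub_zero, Nat.reduceSub,
    Nat.choose_zero_right, Nat.choose_one_right, Nat.choose_self, Nat.cast_one, Nat.cast_ofNat,
    one_mul, zero_add, Real.norm_eq_abs, abs_of_pos hw] at h
  have h3 := norm_fderiv_weight_le hε x
  have h4 := norm_iteratedFDeriv_two_weight_le hε x
  have h5 := sq_mul_weight_le_one hε x
  calc _ ≤ ε * (|a x| * ‖iteratedFDeriv ℝ 2 (weight ε) x‖ +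
        2 * ‖fderiv ℝ a x‖ * ‖fderiv ℝ (weight ε) x‖ +
          ‖iteratedFDeriv ℝ 2 a x‖ * weight ε x) := by gcongr
    _ ≤ ε * (M * ‖x‖ ^ 2 * (10 * weight ε x ^ 2) +
        2 * (M * ‖x‖) * (2 * ‖x‖ * weight ε x ^ 2) + M * weight ε x) := by
        gcongr
        · exact h0 x
        · exact h1 x
        · exact h2 x
    _ = ε * M * weight ε x * (14 * (‖x‖ ^ 2 * weight ε x) + 1) := by ring
    _ ≤ ε * M * weight ε x * (14 * 1 + 1) := by gcongr
    _ = _ := by ring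

end Weight

/-! ### Stability of the bounds `ε^{1 - m/2}` under fixed smooth operations. -/

section ScaledBound

variable {E : Type*} [NormedAddCommGroup E] [NormedSpace ℝ E]

/-- The family `f ε` is smooth and, on the set `s`, its derivatives of order `m ≤ 2` are
`O(ε^{1 - m/2})`. -/
def ScaledBound (s : Set E) (f : ℝ → E → ℝ) : Prop :=
  (∀ ε, 0 < ε → ContDiff ℝ ∞ (f ε)) ∧ ∃ C : ℝ, 0 ≤ C ∧ ∀ ε, 0 < ε → ε ≤ 1 → ∀ m : ℕ, m ≤ 2 →
    ∀ x ∈ s, ‖iteratedFDeriv ℝ m (f ε) x‖ ≤ C * ε ^ (1 - (m : ℝ) / 2)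

/-- For `ε ≤ 1` lower-order derivatives satisfy the stronger bound, so derivatives falling on a
fixed smooth factor do no harm. -/
theorem rpow_scale_mono {ε : ℝ} (hε : 0 < ε) (hε1 : ε ≤ 1) {i m : ℕ} (him : i ≤ m) :
    ε ^ (1 - (i : ℝ) / 2) ≤ ε ^ (1 - (m : ℝ) / 2) := by
  apply Real.rpow_le_rpow_of_exponent_ge hε hε1
  have : (i : ℝ) ≤ m := by exact_mod_cast him
  linarith

theorem ScaledBound.add {s : Set E} {f g : ℝ → E → ℝ} (hf : ScaledBound s f)
    (hg : ScaledBound s g) : ScaledBound s fun ε x => f ε x + g ε x := by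
  obtain ⟨hf, C, hC, hfC⟩ := hf
  obtain ⟨hg, D, hD, hgD⟩ := hg
  refine ⟨fun ε hε => (hf ε hε).add (hg ε hε), C + D, by positivity, fun ε hε hε1 m hm x hx => ?_⟩
  have h : iteratedFDeriv ℝ m (fun x => f ε x + g ε x) x =
      iteratedFDeriv ℝ m (f ε) x + iteratedFDeriv ℝ m (g ε) x :=
    iteratedFDeriv_add_apply ((hf ε hε).contDiffAt.of_le (by exact_mod_cast le_top))
      ((hg ε hε).contDiffAt.of_le (by exact_mod_cast le_top))
  rw [h, add_mul]
  exact (norm_add_le _ _).trans (add_le_add (hfC ε hε hε1 m hm x hx) (hgD ε hε hε1 m hm x hx))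

theorem ScaledBound.sum {ι : Type*} {s : Set E} {f : ι → ℝ → E → ℝ} (t : Finset ι)
    (hf : ∀ i, ScaledBound s (f i)) : ScaledBound s fun ε x => ∑ i ∈ t, f i ε x := by
  classical
  induction t using Finset.induction_on with
  | empty =>
    refine ⟨fun ε _ => by simpa using contDiff_const, 0, le_rfl, fun ε hε hε1 m hm x hx => ?_⟩
    simp [show (fun _ : E => (0 : ℝ)) = 0 from rfl]
  | insert i t hi ih =>
    simp only [Finset.sum_insert hi]
    exact (hf i).add ih

theorem exists_iteratedFDeriv_le_of_isCompact {F : Type*} [NormedAddCommGroup F] [NormedSpace ℝ F]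
    {s : Set E} (hs : IsCompact s) {f : E → F} (hf : ContDiff ℝ ∞ f) :
    ∃ C : ℝ, 1 ≤ C ∧ ∀ m : ℕ, m ≤ 2 → ∀ x ∈ s, ‖iteratedFDeriv ℝ m f x‖ ≤ C := by
  have h : ∀ m : ℕ, ∃ C : ℝ, ∀ x ∈ s, ‖iteratedFDeriv ℝ m f x‖ ≤ C := fun m =>
    hs.exists_bound_of_continuousOn
      (hf.continuous_iteratedFDeriv (by exact_mod_cast le_top)).continuousOn
  choose C hC using h
  refine ⟨max 1 (max (C 0) (max (C 1) (C 2))), le_max_left _ _, fun m hm x hx => ?_⟩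
  refine (hC m x hx).trans ?_
  interval_cases m <;> simp

theorem ScaledBound.mul_left {s : Set E} (hs : IsCompact s) {f : ℝ → E → ℝ} (hf : ScaledBound s f)
    {χ : E → ℝ} (hχ : ContDiff ℝ ∞ χ) : ScaledBound s fun ε x => χ x * f ε x := by
  obtain ⟨hf, C, hC, hfC⟩ := hf
  obtain ⟨D, hD, hχD⟩ := exists_iteratedFDeriv_le_of_isCompact hs hχ
  refine ⟨fun ε hε => hχ.mul (hf ε hε), 4 * D * C, by positivity, fun ε hε hε1 m hm x hx => ?_⟩
  refine (norm_iteratedFDeriv_mul_le hχ (hf ε hε) x (n := m) (by exact_mod_cast le_top)).trans ?_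
  have hterm : ∀ i ∈ Finset.range (m + 1),
      (m.choose i : ℝ) * ‖iteratedFDeriv ℝ i χ x‖ * ‖iteratedFDeriv ℝ (m - i) (f ε) x‖ ≤
        (m.choose i : ℝ) * (D * (C * ε ^ (1 - (m : ℝ) / 2))) := by
    intro i hi
    have hi' : i ≤ m := Nat.lt_succ_iff.1 (Finset.mem_range.1 hi)
    rw [mul_assoc]
    gcongr
    · exact hχD i (hi'.trans hm) x hx
    · refine (hfC ε hε hε1 (m - i) (by omega) x hx).trans ?_
      gcongr C * ?_
      exact rpow_scale_mono hε hε1 (Nat.sub_le m i)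
  refine (Finset.sum_le_sum hterm).trans ?_
  rw [← Finset.sum_mul]
  have hsum : ∑ i ∈ Finset.range (m + 1), (m.choose i : ℝ) ≤ 4 := by
    have := Nat.sum_range_choose m
    have h4 : (2 : ℕ) ^ m ≤ 4 := by interval_cases m <;> norm_num
    rw [← this] at h4
    exact_mod_cast h4
  calc _ ≤ 4 * (D * (C * ε ^ (1 - (m : ℝ) / 2))) := by gcongr
    _ = _ := by ring

/-- The inner map must not depend on `ε`; this is where a number of Euler steps uniform in `ε`
matters. -/
theorem ScaledBound.comp {s : Set E} (hs : IsCompact s) {f : ℝ → E → ℝ}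
    (hf : ScaledBound Set.univ f) {φ : E → E} (hφ : ContDiff ℝ ∞ φ) :
    ScaledBound s fun ε x => f ε (φ x) := by
  obtain ⟨hf, C, hC, hfC⟩ := hf
  obtain ⟨D, hD, hφD⟩ := exists_iteratedFDeriv_le_of_isCompact hs hφ
  refine ⟨fun ε hε => (hf ε hε).comp hφ, 2 * C * D ^ 2, by positivity,
    fun ε hε hε1 m hm x hx => ?_⟩
  refine (norm_iteratedFDeriv_comp_le (hf ε hε) hφ (n := m) (by exact_mod_cast le_top) x
    (C := C * ε ^ (1 - (m : ℝ) / 2)) (D := D) (fun i hi => ?_) (fun i hi him => ?_)).trans ?_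
  · refine (hfC ε hε hε1 i (hi.trans hm) _ trivial).trans ?_
    gcongr C * ?_
    exact rpow_scale_mono hε hε1 hi
  · exact (hφD i (him.trans hm) x hx).trans (le_self_pow₀ hD (by omega))
  · have h1 : (m.factorial : ℝ) ≤ 2 := by
      have := Nat.factorial_le hm
      exact_mod_cast this
    have h2 : D ^ m ≤ D ^ 2 := pow_le_pow_right₀ hD hm
    calc _ ≤ 2 * (C * ε ^ (1 - (m : ℝ) / 2)) * D ^ 2 := by gcongr
      _ = _ := by ring

theorem scaledBound_truncation {E : Type*} [NormedAddCommGroup E] [InnerProductSpace ℝ E]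
    {a : E → ℝ} {M : ℝ} (ha : ContDiff ℝ ∞ a) (hM : 0 ≤ M)
    (h0 : ∀ x, |a x| ≤ M * ‖x‖ ^ 2) (h1 : ∀ x, ‖fderiv ℝ a x‖ ≤ M * ‖x‖)
    (h2 : ∀ x, ‖iteratedFDeriv ℝ 2 a x‖ ≤ M) : ScaledBound Set.univ (truncation a) := by
  refine ⟨fun ε hε => contDiff_truncation ha hε, 15 * M, by positivity,
    fun ε hε hε1 m hm x _ => ?_⟩
  have hw := weight_pos hε x
  interval_cases m
  · rw [norm_iteratedFDeriv_zero, Real.norm_eq_abs]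
    refine (abs_truncation_le hM h0 hε x).trans ?_
    norm_num
    nlinarith [mul_nonneg hM hε.le]
  · rw [norm_iteratedFDeriv_one]
    refine (norm_fderiv_truncation_le ha hM h0 h1 hε x).trans ?_
    have h3 : ε ^ (1 - ((1 : ℕ) : ℝ) / 2) = √ε := by
      rw [Real.sqrt_eq_rpow]; norm_num
    rw [h3]
    have hq : √ε * √ε = ε := Real.mul_self_sqrt hε.le
    have hq0 : 0 ≤ √ε := Real.sqrt_nonneg _
    have h4 : √ε * ‖x‖ * weight ε x ≤ 1 := by
      unfold weight
      rw [← div_eq_mul_inv, div_le_one (by positivity)]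
      nlinarith [sq_nonneg (√ε - ‖x‖)]
    calc 3 * M * (ε * ‖x‖ * weight ε x) = 3 * M * √ε * (√ε * ‖x‖ * weight ε x) := by
          nth_rewrite 1 [← hq]; ring
      _ ≤ 3 * M * √ε * 1 := by gcongr
      _ ≤ _ := by nlinarith [mul_nonneg hM hq0]
  · refine (norm_iteratedFDeriv_two_truncation_le ha hM h0 h1 h2 hε x).trans ?_
    norm_num
    have := mul_weight_le_one hε x
    nlinarith

end ScaledBound

/-! ### Construction of the escape function. -/

section Escape

/-- Abel summation. With `c = 1/m` the term at `m` drops out and the average minus the initial value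
remains. -/
theorem sum_weighted_differences (f : ℕ → ℝ) (c : ℝ) (m : ℕ) :
    ∑ j ∈ Finset.range m, (1 - j * c) * (f (j + 1) - f j) =
      (1 - m * c) * f m - f 0 + c * ∑ j ∈ Finset.range m, f (j + 1) := by
  induction m with
  | zero => simp
  | succ m ih =>
    rw [Finset.sum_range_succ, Finset.sum_range_succ, ih]
    push_cast
    ring

variable {E : Type*} [NormedAddCommGroup E] [InnerProductSpace ℝ E]

/-- The Euler-scheme version of `∫₀^S (1 - t/S) k(e^{tv} x) dt`, with `N` steps. -/
noncomputable def discreteAverage (v : E → E) (k : E → ℝ) (S : ℝ) (N : ℕ) (x : E) : ℝ :=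
  ∑ j ∈ Finset.range N, S / N * (1 - j * (N : ℝ)⁻¹) * k (euler v (S / N) j x)

theorem fderiv_discreteAverage {v : E → E} {k : E → ℝ} (hv : ContDiff ℝ ∞ v) (hk : ContDiff ℝ ∞ k)
    (S : ℝ) (N : ℕ) (x : E) :
    fderiv ℝ (discreteAverage v k S N) x =
      ∑ j ∈ Finset.range N, (S / N * (1 - j * (N : ℝ)⁻¹)) •
        (fderiv ℝ k (euler v (S / N) j x)).comp (fderiv ℝ (euler v (S / N) j) x) := by
  refine HasFDerivAt.fderiv ?_
  unfold discreteAverage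
  refine HasFDerivAt.fun_sum fun j _ => HasFDerivAt.const_mul ?_ _
  exact (hk.differentiable (by simp) _).hasFDerivAt.comp x
    ((contDiff_euler hv _ j).differentiable (by simp) x).hasFDerivAt

open scoped NNReal in
/-- A vector field with an equilibrium at the origin together with a nonnegative function that
vanishes to second order there. -/
structure EscapeData (v : E → E) (a : E → ℝ) (K : ℝ≥0) (M : ℝ) : Prop where
  smooth_field : ContDiff ℝ ∞ v
  norm_field_le : ∀ x, ‖v x‖ ≤ K * ‖x‖
  lipschitz : LipschitzWith K v
  second_field : ∀ x, ‖iteratedFDeriv ℝ 2 v x‖ ≤ M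
  smooth : ContDiff ℝ ∞ a
  nonneg : ∀ x, 0 ≤ a x
  abs_le : ∀ x, |a x| ≤ M * ‖x‖ ^ 2
  norm_fderiv_le : ∀ x, ‖fderiv ℝ a x‖ ≤ M * ‖x‖
  second_le : ∀ x, ‖iteratedFDeriv ℝ 2 a x‖ ≤ M

open scoped NNReal

variable {v : E → E} {a : E → ℝ} {K : ℝ≥0} {M : ℝ}

theorem EscapeData.bound_nonneg (h : EscapeData v a K M) : 0 ≤ M :=
  (norm_nonneg _).trans (h.second_le 0)

theorem EscapeData.abs_sub_le (h : EscapeData v a K M) (x y : E) :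
    |a x - a y| ≤ M * (‖x‖ + ‖y‖) * ‖x - y‖ := by
  have hM := h.bound_nonneg
  have := (convex_segment y x).norm_image_sub_le_of_norm_fderiv_le (𝕜 := ℝ) (f := a)
    (C := M * (‖x‖ + ‖y‖)) (fun z _ => h.smooth.differentiable (by simp) z) (fun z hz => ?_)
    (left_mem_segment ℝ y x) (right_mem_segment ℝ y x)
  · exact this
  · refine (h.norm_fderiv_le z).trans ?_
    gcongr
    obtain ⟨s, t, hs, ht, hst, rfl⟩ := hz
    refine (norm_add_le _ _).trans ?_
    rw [norm_smul, norm_smul, Real.norm_of_nonneg hs, Real.norm_of_nonneg ht]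
    nlinarith [norm_nonneg x, norm_nonneg y]

/-- One step of the telescoping argument: along the Euler scheme, the derivative of the truncated
function in the direction of the transported field is a difference, up to second order. -/
theorem EscapeData.exists_step_le (h : EscapeData v a K M) {S R : ℝ} (hR : 0 ≤ R) (hS : 0 ≤ S) :
    ∃ C : ℝ, 0 ≤ C ∧ ∀ ε η : ℝ, 0 < ε → 0 ≤ η → η * K ≤ 1 / 2 → ∀ N : ℕ, N * η ≤ S → ∀ j < N, ∀ x : E,
      ‖x‖ ≤ R →
      |η * fderiv ℝ (truncation a ε) (euler v η j x) (fderiv ℝ (euler v η j) x (v x)) -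
        (truncation a ε (euler v η (j + 1) x) - truncation a ε (euler v η j x))| ≤
          C * η ^ 2 * (ε * ‖x‖ ^ 2 * weight ε x) := by
  have hM := h.bound_nonneg
  set A := Real.exp (K * S) with hA
  set B := Real.exp (2 * K * S) with hB
  have hB1 : 1 ≤ B := Real.one_le_exp (by positivity)
  -- The first term is the error of transporting `v` by the differential of the scheme; it is cubic
  -- in `‖x‖`, hence the factor `R`. The second is the Taylor remainder of the truncation over one
  -- step.
  refine ⟨3 * M * (A * B ^ 2) * (S * (M * (K * A) ^ 2) * A * R) +
    15 * M * (4 * B ^ 2) * (K * A) ^ 2, by positivity, fun ε η hε hη hηK N hN j hj x hx => ?_⟩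
  have hjS : j * η ≤ S := le_trans (by gcongr) hN
  set y := euler v η j x with hy
  have hyx : ‖y‖ ≤ A * ‖x‖ := norm_euler_le K.coe_nonneg hη h.norm_field_le hjS x
  have hxy : ‖x‖ ≤ B * ‖y‖ := norm_le_norm_euler K.coe_nonneg hη hηK h.norm_field_le hjS x
  have hwy : weight ε y ≤ B ^ 2 * weight ε x := weight_le_of_norm_le hε hB1 hxy
  have hwx := weight_pos hε x
  have hwy0 := weight_pos hε y
  set k := truncation a ε with hk
  have hks : ContDiff ℝ ∞ k := contDiff_truncation h.smooth hε
  have hstep : euler v η (j + 1) x = y + η • v y := rfl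
  rw [hstep]
  have hu : ‖v y‖ ≤ K * (A * ‖x‖) := (h.norm_field_le y).trans (by gcongr)
  have hT : |k (y + η • v y) - k y - fderiv ℝ k y (η • v y)| ≤
      15 * M * (ε * (4 * (B ^ 2 * weight ε x))) * (η * (K * (A * ‖x‖))) ^ 2 := by
    have h1 := norm_taylor_one_le_of_segment hks (x := y) (y := y + η • v y)
      (B := 15 * M * (ε * (4 * (B ^ 2 * weight ε x)))) (fun z hz => ?_)
    · rw [add_sub_cancel_left, norm_smul, Real.norm_of_nonneg hη, Real.norm_eq_abs] at h1
      refine h1.trans ?_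
      gcongr
    · refine (norm_iteratedFDeriv_two_truncation_le h.smooth hM h.abs_le h.norm_fderiv_le
        h.second_le hε z).trans ?_
      gcongr
      -- Since `ηK ≤ 1/2`, a step moves `y` by at most half its norm, so the weight is comparable
      -- along the whole segment.
      have h2 : ‖y‖ ≤ 2 * ‖z‖ := by
        obtain ⟨s, hs, rfl⟩ := (segment_eq_image' ℝ y (y + η • v y) ▸ hz :)
        simp only [add_sub_cancel_left]
        have h3 : ‖s • η • v y‖ ≤ 1 / 2 * ‖y‖ := by
          rw [norm_smul, norm_smul, Real.norm_of_nonneg hs.1, Real.norm_of_nonneg hη]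
          calc s * (η * ‖v y‖) ≤ 1 * (η * (K * ‖y‖)) := by
                have := hs.2
                have := h.norm_field_le y
                gcongr
            _ = η * K * ‖y‖ := by ring
            _ ≤ _ := by gcongr
        have h4 := norm_sub_le_norm_add y (s • η • v y)
        linarith
      have h5 := weight_le_of_norm_le hε (by norm_num : (1 : ℝ) ≤ 2) h2
      linarith
  have hW := norm_fderiv_euler_apply_sub_le hη h.smooth_field h.norm_field_le h.lipschitz
    h.second_field hN x j hj.le
  rw [← hy, ← hA] at hW
  set w := fderiv ℝ (euler v η j) x (v x) with hw
  have hD : |fderiv ℝ k y (w - v y)| ≤ 3 * M * (ε * (A * ‖x‖) * (B ^ 2 * weight ε x)) *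
      (S * (η * (M * (K * (A * ‖x‖)) ^ 2)) * A) := by
    refine ((fderiv ℝ k y).le_opNorm _).trans ?_
    refine mul_le_mul ((norm_fderiv_truncation_le h.smooth hM h.abs_le h.norm_fderiv_le hε
      y).trans ?_) hW (norm_nonneg _) (by positivity)
    gcongr
  have hsplit : η * fderiv ℝ k y w - (k (y + η • v y) - k y) =
      η * fderiv ℝ k y (w - v y) - (k (y + η • v y) - k y - fderiv ℝ k y (η • v y)) := by
    rw [map_sub, map_smul, smul_eq_mul]
    ring
  rw [hsplit]
  refine (abs_sub _ _).trans ?_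
  rw [abs_mul, abs_of_nonneg hη]
  calc _ ≤ η * (3 * M * (ε * (A * ‖x‖) * (B ^ 2 * weight ε x)) *
        (S * (η * (M * (K * (A * ‖x‖)) ^ 2)) * A)) +
        15 * M * (ε * (4 * (B ^ 2 * weight ε x))) * (η * (K * (A * ‖x‖))) ^ 2 := by gcongr
    _ = (3 * M * (A * B ^ 2) * (S * (M * (K * A) ^ 2) * A * ‖x‖) +
        15 * M * (4 * B ^ 2) * (K * A) ^ 2) * η ^ 2 * (ε * ‖x‖ ^ 2 * weight ε x) := by ring
    _ ≤ _ := by gcongr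

/-- Existence of the number of Euler steps for which the discrete average of the truncated
function is an escape function on a ball. -/
theorem EscapeData.exists_discreteAverage (h : EscapeData v a K M) {S R c : ℝ} (hS : 0 < S)
    (hR : 0 ≤ R) (hc : 0 < c)
    (hcurve : ∀ x, ‖x‖ ≤ R → ∃ γ : ℝ → E, γ 0 = x ∧ (∀ t, HasDerivAt γ (v (γ t)) t) ∧
      c * ‖x‖ ^ 2 ≤ ∫ t in (0)..S, a (γ t)) :
    ∃ (N : ℕ) (C c' : ℝ), 0 < C ∧ 0 < c' ∧ ∀ ε, 0 < ε → ∀ x, ‖x‖ ≤ R →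
      ‖fderiv ℝ (discreteAverage v (truncation a ε) S N) x‖ ^ 2 ≤
        C * (ε * ‖x‖ ^ 2 * weight ε x) ∧
      -a x + c' * (ε * ‖x‖ ^ 2 * weight ε x) ≤
        fderiv ℝ (discreteAverage v (truncation a ε) S N) x (v x) := by
  have hM := h.bound_nonneg
  obtain ⟨C₁, hC₁, hstep⟩ := h.exists_step_le hR hS.le
  obtain ⟨C₂, hC₂, hsum⟩ := exists_euler_sum_sub_integral_le hS h.norm_field_le h.lipschitz
    h.smooth.continuous hM h.abs_sub_le
  set A := Real.exp (K * S) with hA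
  set B := Real.exp (2 * K * S) with hB
  have hA1 : 1 ≤ A := Real.one_le_exp (by positivity)
  have hB1 : 1 ≤ B := Real.one_le_exp (by positivity)
  -- Half of `c` survives the Riemann-sum error, `1/S` comes from averaging, and `A²` from comparing
  -- weights at `x` and along the scheme.
  set c₁ := c / (2 * S * A ^ 2) with hc₁
  have hc₁0 : 0 < c₁ := by positivity
  -- The thresholds make the step at most `1/(2K)`, the Riemann-sum error at most `c/2`, and the
  -- accumulated telescoping error at most `c₁/2`. None involves `ε`.
  obtain ⟨N, hN⟩ := exists_nat_gt
    (max 0 (max (2 * S * K) (max (2 * C₂ * S / c) (2 * S * C₁ * S / c₁))))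
  simp only [max_lt_iff] at hN
  obtain ⟨hN0, hN1, hN2, hN3⟩ := hN
  set η := S / N with hη
  have hη0 : 0 < η := by positivity
  have hNη : N * η = S := by rw [hη]; field_simp
  have hηK : η * K ≤ 1 / 2 := by
    rw [hη, div_mul_eq_mul_div, div_le_iff₀ hN0]; linarith
  have hηc : C₂ * η ≤ c / 2 := by
    rw [div_lt_iff₀ hc] at hN2
    rw [hη, ← mul_div_assoc, div_le_iff₀ hN0]; linarith
  have hηc₁ : S * C₁ * η ≤ c₁ / 2 := by
    rw [div_lt_iff₀ hc₁0] at hN3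
    rw [hη, ← mul_div_assoc, div_le_iff₀ hN0]; linarith
  have hN0' : 0 < N := by exact_mod_cast hN0
  refine ⟨N, (S * (3 * M * (A * B ^ 2) * A)) ^ 2 + 1, c₁ / 2, by positivity, by positivity,
    fun ε hε x hx => ?_⟩
  set k := truncation a ε with hk
  have hks : ContDiff ℝ ∞ k := contDiff_truncation h.smooth hε
  have hwx := weight_pos hε x
  have hcoef0 : ∀ j ∈ Finset.range N, 0 ≤ 1 - (j : ℝ) * (N : ℝ)⁻¹ := fun j hj => by
    have : (j : ℝ) ≤ N := by exact_mod_cast (Finset.mem_range.1 hj).le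
    rw [sub_nonneg, ← div_eq_mul_inv, div_le_one hN0]
    exact this
  have hcoef1 : ∀ j : ℕ, 1 - (j : ℝ) * (N : ℝ)⁻¹ ≤ 1 := fun j => by
    have : 0 ≤ (j : ℝ) * (N : ℝ)⁻¹ := by positivity
    linarith
  rw [fderiv_discreteAverage h.smooth_field hks, ← hη]
  constructor
  · have hterm : ∀ j ∈ Finset.range N, ‖(η * (1 - j * (N : ℝ)⁻¹)) •
        (fderiv ℝ k (euler v η j x)).comp (fderiv ℝ (euler v η j) x)‖ ≤
          η * (3 * M * (ε * (A * ‖x‖) * (B ^ 2 * weight ε x)) * A) := by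
      intro j hj
      have hjN : j < N := Finset.mem_range.1 hj
      have hjS : j * η ≤ S := by rw [← hNη]; gcongr
      have hyx : ‖euler v η j x‖ ≤ A * ‖x‖ :=
        norm_euler_le K.coe_nonneg hη0.le h.norm_field_le hjS x
      have hxy := norm_le_norm_euler K.coe_nonneg hη0.le hηK h.norm_field_le hjS x
      have hwy := weight_le_of_norm_le hε hB1 hxy
      have hwy0 := weight_pos hε (euler v η j x)
      have hj0 := hcoef0 j hj
      rw [norm_smul, Real.norm_of_nonneg (by positivity)]
      calc _ ≤ η * 1 * (‖fderiv ℝ k (euler v η j x)‖ * ‖fderiv ℝ (euler v η j) x‖) := by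
            gcongr
            · exact hcoef1 j
            · exact ContinuousLinearMap.opNorm_comp_le _ _
        _ ≤ η * 1 * (3 * M * (ε * (A * ‖x‖) * (B ^ 2 * weight ε x)) * A) := by
            gcongr
            · refine (norm_fderiv_truncation_le h.smooth hM h.abs_le h.norm_fderiv_le hε
                _).trans ?_
              gcongr
            · exact norm_fderiv_euler_le hη0.le h.smooth_field h.lipschitz hjS x
        _ = _ := by ring
    have hnorm := (norm_sum_le _ _).trans (Finset.sum_le_sum hterm)
    rw [Finset.sum_const, Finset.card_range, nsmul_eq_mul, ← mul_assoc, hNη] at hnorm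
    have h1 := mul_weight_le_one hε x
    have h2 : 0 ≤ ε * ‖x‖ ^ 2 * weight ε x := by positivity
    calc _ ≤ (S * (3 * M * (ε * (A * ‖x‖) * (B ^ 2 * weight ε x)) * A)) ^ 2 := by gcongr
      _ = (S * (3 * M * (A * B ^ 2) * A)) ^ 2 * (ε * ‖x‖ ^ 2 * weight ε x) *
          (ε * weight ε x) := by ring
      _ ≤ (S * (3 * M * (A * B ^ 2) * A)) ^ 2 * (ε * ‖x‖ ^ 2 * weight ε x) * 1 := by gcongr
      _ ≤ _ := by rw [add_mul]; linarith
  · rw [sum_apply]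
    simp only [smul_apply, ContinuousLinearMap.comp_apply, smul_eq_mul]
    set μ := ε * ‖x‖ ^ 2 * weight ε x with hμ
    have hμ0 : 0 ≤ μ := by positivity
    -- Each derivative term is replaced by a difference; since the coefficients lie in `[0, 1]`, the
    -- `N` errors `C₁η²μ` add up to at most `SC₁ημ`.
    have hdiff : ∑ j ∈ Finset.range N, (1 - (j : ℝ) * (N : ℝ)⁻¹) *
          (k (euler v η (j + 1) x) - k (euler v η j x)) - S * C₁ * η * μ ≤
        ∑ j ∈ Finset.range N, η * (1 - (j : ℝ) * (N : ℝ)⁻¹) *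
          fderiv ℝ k (euler v η j x) (fderiv ℝ (euler v η j) x (v x)) := by
      have h1 : S * C₁ * η * μ = ∑ _j ∈ Finset.range N, C₁ * η ^ 2 * μ := by
        rw [Finset.sum_const, Finset.card_range, nsmul_eq_mul, ← hNη]; ring
      rw [h1, ← Finset.sum_sub_distrib]
      refine Finset.sum_le_sum fun j hj => ?_
      have h2 := (_root_.abs_le.1 (hstep ε η hε hη0.le hηK N hNη.le j (Finset.mem_range.1 hj) x hx)).1
      have h3 := hcoef0 j hj
      have h4 := hcoef1 j
      have h5 : 0 ≤ C₁ * η ^ 2 * μ := by positivity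
      have h6 := mul_le_mul_of_nonneg_left h2 h3
      have h7 := mul_le_mul_of_nonneg_right h4 h5
      linarith
    rw [sum_weighted_differences (fun j => k (euler v η j x)), mul_inv_cancel₀ hN0.ne', sub_self,
      zero_mul, zero_sub] at hdiff
    have hk0 : k (euler v η 0 x) ≤ a x := truncation_le h.nonneg hε x
    have hlow : ε * (A ^ 2)⁻¹ * weight ε x * ∑ j ∈ Finset.range N, a (euler v η (j + 1) x) ≤
        ∑ j ∈ Finset.range N, k (euler v η (j + 1) x) := by
      rw [Finset.mul_sum]
      refine Finset.sum_le_sum fun j hj => ?_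
      have hjS : ((j + 1 : ℕ) : ℝ) * η ≤ S := by
        rw [← hNη]
        exact mul_le_mul_of_nonneg_right (by exact_mod_cast Finset.mem_range.1 hj) hη0.le
      have hyx : ‖euler v η (j + 1) x‖ ≤ A * ‖x‖ :=
        norm_euler_le K.coe_nonneg hη0.le h.norm_field_le hjS x
      have h1 := weight_le_of_norm_le hε hA1 hyx
      have h2 : (A ^ 2)⁻¹ * weight ε x ≤ weight ε (euler v η (j + 1) x) := by
        rw [inv_mul_le_iff₀ (by positivity)]; exact h1
      have h3 := h.nonneg (euler v η (j + 1) x)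
      calc _ = ε * (a (euler v η (j + 1) x) * ((A ^ 2)⁻¹ * weight ε x)) := by ring
        _ ≤ _ := by rw [hk, truncation]; gcongr
    have havg : c / 2 * ‖x‖ ^ 2 ≤ η * ∑ j ∈ Finset.range N, a (euler v η (j + 1) x) := by
      obtain ⟨γ, hγ0, hγ, hγc⟩ := hcurve x hx
      have h1 := (_root_.abs_le.1 (hsum N hN0' γ hγ)).1
      rw [hγ0, ← hη] at h1
      have h2 : C₂ * η * ‖x‖ ^ 2 ≤ c / 2 * ‖x‖ ^ 2 := by gcongr
      linarith
    have hfin : c₁ * μ ≤ (N : ℝ)⁻¹ * ∑ j ∈ Finset.range N, k (euler v η (j + 1) x) := by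
      have hNS : (N : ℝ)⁻¹ = η / S := by rw [hη]; field_simp
      calc c₁ * μ = ε * (A ^ 2)⁻¹ * weight ε x / S * (c / 2 * ‖x‖ ^ 2) := by
            rw [hc₁, hμ]; field_simp
        _ ≤ ε * (A ^ 2)⁻¹ * weight ε x / S *
            (η * ∑ j ∈ Finset.range N, a (euler v η (j + 1) x)) := by gcongr
        _ = η / S * (ε * (A ^ 2)⁻¹ * weight ε x *
            ∑ j ∈ Finset.range N, a (euler v η (j + 1) x)) := by ring
        _ ≤ η / S * ∑ j ∈ Finset.range N, k (euler v η (j + 1) x) := by gcongr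
        _ = _ := by rw [hNS]
    have hsmall : S * C₁ * η * μ ≤ c₁ / 2 * μ := by gcongr
    linarith

/-- Existence of a compactly supported escape function, with the scaled derivative bounds. -/
theorem EscapeData.exists_escape_function [FiniteDimensional ℝ E] (h : EscapeData v a K M)
    {S R c : ℝ} (hS : 0 < S) (hR : 0 ≤ R) (hc : 0 < c)
    (hcurve : ∀ x, ‖x‖ ≤ R → ∃ γ : ℝ → E, γ 0 = x ∧ (∀ t, HasDerivAt γ (v (γ t)) t) ∧
      c * ‖x‖ ^ 2 ≤ ∫ t in (0)..S, a (γ t)) :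
    ∃ (C c' : ℝ) (G : ℝ → E → ℝ), 0 < C ∧ 0 < c' ∧ ∀ ε, 0 < ε → ε ≤ 1 →
      ContDiff ℝ ∞ (G ε) ∧ HasCompactSupport (G ε) ∧
      (∀ m : ℕ, m ≤ 2 → ∀ x, ‖iteratedFDeriv ℝ m (G ε) x‖ ≤ C * ε ^ (1 - (m : ℝ) / 2)) ∧
      ∀ x, ‖x‖ ≤ R → ‖fderiv ℝ (G ε) x‖ ^ 2 ≤ C * (ε * ‖x‖ ^ 2 * weight ε x) ∧
        -a x + c' * (ε * ‖x‖ ^ 2 * weight ε x) ≤ fderiv ℝ (G ε) x (v x) := by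
  obtain ⟨N, C, c', hC, hc', hN⟩ := h.exists_discreteAverage hS hR hc hcurve
  -- Inner radius `R + 1`, so the cutoff equals 1 near every point of the closed ball of radius `R`
  -- and does not affect derivatives there.
  let χ : ContDiffBump (0 : E) := ⟨R + 1, R + 2, by linarith, by linarith⟩
  have hχ : ContDiff ℝ ∞ χ := χ.contDiff
  have hcpt : IsCompact (tsupport χ) := χ.hasCompactSupport
  have hk := scaledBound_truncation h.smooth h.bound_nonneg h.abs_le h.norm_fderiv_le h.second_le
  have hG : ScaledBound (tsupport χ)
      fun ε x => χ x * discreteAverage v (truncation a ε) S N x := by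
    refine ScaledBound.mul_left hcpt (ScaledBound.sum _ fun j => ?_) hχ
    exact ScaledBound.mul_left hcpt (hk.comp hcpt (contDiff_euler h.smooth_field _ j))
      contDiff_const
  obtain ⟨hGs, D, hD, hGD⟩ := hG
  refine ⟨C + D, c', fun ε x => χ x * discreteAverage v (truncation a ε) S N x, by positivity,
    hc', fun ε hε hε1 => ⟨hGs ε hε, χ.hasCompactSupport.mul_right, fun m hm x => ?_,
      fun x hx => ?_⟩⟩
  · by_cases hx : x ∈ tsupport χ
    · refine (hGD ε hε hε1 m hm x hx).trans ?_
      gcongr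
      linarith
    · have h1 : iteratedFDeriv ℝ m (fun x => χ x * discreteAverage v (truncation a ε) S N x) x =
          0 := by
        by_contra hne
        exact hx (closure_mono (Function.support_mul_subset_left _ _)
          (support_iteratedFDeriv_subset (𝕜 := ℝ) m hne))
      rw [h1, norm_zero]
      positivity
  · have heq : (fun x => χ x * discreteAverage v (truncation a ε) S N x) =ᶠ[nhds x]
        discreteAverage v (truncation a ε) S N := by
      filter_upwards [Metric.isOpen_ball.mem_nhds
        (by simpa using (by linarith : ‖x‖ < R + 1) : x ∈ Metric.ball (0 : E) (R + 1))] with y hy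
      rw [χ.one_of_mem_closedBall (Metric.ball_subset_closedBall hy), one_mul]
    rw [heq.fderiv_eq]
    refine ⟨((hN ε hε x hx).1).trans ?_, (hN ε hε x hx).2⟩
    have := weight_pos hε x
    gcongr
    linarith

end Escape

/-! ### Taylor expansion of the extension at real points. -/

section AlmostHolomorphic

variable {n : ℕ}

/-- The real embedding `X ↦ X + i0` of phase space into its complexification. -/
noncomputable def realEmbedding (n : ℕ) : Phase n →L[ℝ] CPhase n :=
  LinearMap.toContinuousLinearMap
    { toFun := fun X => complexPoint X 0
      map_add' := fun X Y => by ext j; simp [complexPoint]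
      map_smul' := fun c X => by ext j; simp [complexPoint] }

/-- The embedding `Y ↦ 0 + iY` of phase space into its complexification. -/
noncomputable def imEmbedding (n : ℕ) : Phase n →L[ℝ] CPhase n :=
  LinearMap.toContinuousLinearMap
    { toFun := fun Y => complexPoint 0 Y
      map_add' := fun X Y => by ext j; simp [complexPoint, mul_add]
      map_smul' := fun c X => by ext j; simp [complexPoint, mul_left_comm] }

theorem realEmbedding_apply (X : Phase n) : realEmbedding n X = complexPoint X 0 := rfl

theorem complexPoint_eq (X Y : Phase n) :
    complexPoint X Y = realEmbedding n X + imEmbedding n Y := by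
  ext j
  simp [realEmbedding, imEmbedding, complexPoint]

theorem realEmbedding_single (j : Fin n ⊕ Fin n) :
    realEmbedding n (EuclideanSpace.single j 1) = EuclideanSpace.single j 1 := by
  ext i
  by_cases h : i = j <;> simp [realEmbedding, complexPoint, h]

theorem imEmbedding_single (j : Fin n ⊕ Fin n) :
    imEmbedding n (EuclideanSpace.single j 1) = EuclideanSpace.single j Complex.I := by
  ext i
  by_cases h : i = j <;> simp [imEmbedding, complexPoint, h]

theorem sum_smul_single (X : Phase n) : X = ∑ j, X j • EuclideanSpace.single j (1 : ℝ) := by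
  conv_lhs => rw [← (EuclideanSpace.basisFun (Fin n ⊕ Fin n) ℝ).sum_repr X]
  simp

variable {p : Phase n → ℂ} {f : CPhase n → ℂ}

/-- The bound on `dbar` with exponent 1 forces it to vanish at real points, so the Cauchy-Riemann
equations hold there and the differential is complex linear. -/
theorem IsAlmostHolomorphicExtension.fderiv_imEmbedding (hf : IsAlmostHolomorphicExtension p f)
    (X Y : Phase n) :
    fderiv ℝ f (realEmbedding n X) (imEmbedding n Y) = Complex.I * fderiv ℝ p X Y := by
  have hp : fderiv ℝ p X = (fderiv ℝ f (realEmbedding n X)).comp (realEmbedding n) := by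
    have h1 : p = f ∘ realEmbedding n := funext fun Z => (hf.2.1 Z).symm
    rw [h1]
    exact ((hf.1.differentiable (by simp) _).hasFDerivAt.comp X
      (realEmbedding n).hasFDerivAt).fderiv
  rw [hp, ContinuousLinearMap.comp_apply]
  set D := fderiv ℝ f (realEmbedding n X)
  have hj : ∀ j, D (EuclideanSpace.single j Complex.I) =
      Complex.I * D (EuclideanSpace.single j 1) := by
    intro j
    obtain ⟨C, hC⟩ := hf.2.2 j 1
    have him : imPart (realEmbedding n X) = 0 := by
      ext i
      simp [imPart, realEmbedding, complexPoint]
    have h0 := hC (realEmbedding n X) (by simp [him])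
    rw [him, norm_zero, pow_one, mul_zero, norm_le_zero_iff, dbar] at h0
    have h2 : D (EuclideanSpace.single j 1) + Complex.I * D (EuclideanSpace.single j Complex.I) =
        0 := by
      simpa using h0
    linear_combination -Complex.I * h2 + D (EuclideanSpace.single j Complex.I) * Complex.I_mul_I
  conv_lhs => rw [sum_smul_single Y]
  conv_rhs => rw [sum_smul_single Y]
  simp only [map_sum, map_smul, imEmbedding_single, realEmbedding_single, hj, Finset.mul_sum,
    Complex.real_smul]
  exact Finset.sum_congr rfl fun j _ => by ring

/-- Second-order Taylor expansion of an almost holomorphic extension at a real point in the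
direction of `iH_g`. -/
theorem IsAlmostHolomorphicExtension.le_re_complexPoint (hf : IsAlmostHolomorphicExtension p f)
    (hp : ContDiff ℝ ∞ p) {M : ℝ} (hM : ∀ Z, ‖iteratedFDeriv ℝ 2 f Z‖ ≤ M) (g : Phase n → ℝ)
    (X : Phase n) {δ : ℝ} (hδ : 0 ≤ δ) :
    (p X).re + δ * fderiv ℝ g X (hamVec (fun Y => (p Y).im) X) -
      M * (‖imEmbedding n‖ * (δ * (‖hamMap n‖ * ‖fderiv ℝ g X‖))) ^ 2 ≤
        (f (complexPoint X (δ • hamVec g X))).re := by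
  have hM0 : 0 ≤ M := (norm_nonneg _).trans (hM 0)
  set W := δ • hamVec g X with hW
  have hWn : ‖imEmbedding n W‖ ≤ ‖imEmbedding n‖ * (δ * (‖hamMap n‖ * ‖fderiv ℝ g X‖)) := by
    refine ((imEmbedding n).le_opNorm _).trans ?_
    rw [hW, norm_smul, Real.norm_of_nonneg hδ, hamVec_eq]
    gcongr
    exact (hamMap n).le_opNorm _
  have h1 := norm_taylor_one_le hf.1 hM (realEmbedding n X) (realEmbedding n X + imEmbedding n W)
  rw [add_sub_cancel_left, hf.fderiv_imEmbedding, realEmbedding_apply, hf.2.1,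
    ← realEmbedding_apply, ← complexPoint_eq] at h1
  -- The real part of `i dp(W)` is `-d(Im p)(W)`; antisymmetry makes this `+δ dg(H_{Im p})`, the
  -- sign that lets an escape function help.
  have h2 : -(fderiv ℝ p X W).im = δ * fderiv ℝ g X (hamVec (fun Y => (p Y).im) X) := by
    rw [hW, map_smul, hamVec_eq g, hamVec_im_eq hp, apply_hamMap, Complex.real_smul,
      Complex.im_ofReal_mul]
    simp
  have h3 := (Complex.abs_re_le_norm _).trans h1
  have h4 := (abs_le.1 h3).1
  simp only [Complex.sub_re, Complex.mul_re, Complex.I_re, Complex.I_im] at h4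
  have h5 : M * ‖imEmbedding n W‖ ^ 2 ≤
      M * (‖imEmbedding n‖ * (δ * (‖hamMap n‖ * ‖fderiv ℝ g X‖))) ^ 2 := by gcongr
  linarith

/-- Used far from the origin, where ellipticity leaves room for a crude first-order loss. -/
theorem IsAlmostHolomorphicExtension.re_sub_le_re_complexPoint
    (hf : IsAlmostHolomorphicExtension p f) {M : ℝ} (hM : ∀ Z, ‖iteratedFDeriv ℝ 1 f Z‖ ≤ M)
    (g : Phase n → ℝ) (X : Phase n) {δ : ℝ} (hδ : 0 ≤ δ) :
    (p X).re - M * (‖imEmbedding n‖ * (δ * (‖hamMap n‖ * ‖fderiv ℝ g X‖))) ≤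
      (f (complexPoint X (δ • hamVec g X))).re := by
  have hM0 : 0 ≤ M := (norm_nonneg _).trans (hM 0)
  have h1 := (convex_univ (𝕜 := ℝ) (E := CPhase n)).norm_image_sub_le_of_norm_fderiv_le (𝕜 := ℝ) (f := f)
    (fun z _ => hf.1.differentiable (by simp) z)
    (fun z _ => by rw [← norm_iteratedFDeriv_one]; exact hM z)
    (Set.mem_univ (realEmbedding n X)) (Set.mem_univ (complexPoint X (δ • hamVec g X)))
  rw [complexPoint_eq, add_sub_cancel_left, realEmbedding_apply, hf.2.1, ← realEmbedding_apply,
    ← complexPoint_eq] at h1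
  have h2 := (abs_le.1 ((Complex.abs_re_le_norm _).trans h1)).1
  rw [Complex.sub_re] at h2
  have h3 : ‖imEmbedding n (δ • hamVec g X)‖ ≤
      ‖imEmbedding n‖ * (δ * (‖hamMap n‖ * ‖fderiv ℝ g X‖)) := by
    refine ((imEmbedding n).le_opNorm _).trans ?_
    rw [norm_smul, Real.norm_of_nonneg hδ, hamVec_eq]
    gcongr
    exact (hamMap n).le_opNorm _
  have h4 := mul_le_mul_of_nonneg_left h3 hM0
  linarith

end AlmostHolomorphic

/-! ### The data of the escape construction and the final estimate. -/

section Main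

variable {n : ℕ} {p : Phase n → ℂ} {T : ℝ}

theorem PrincipalSymbolAssumptions.exists_escapeData (hp : PrincipalSymbolAssumptions p T)
    {M₂ M₃ : ℝ} (hM₂ : ∀ X, ‖iteratedFDeriv ℝ 2 p X‖ ≤ M₂)
    (hM₃ : ∀ X, ‖iteratedFDeriv ℝ 3 p X‖ ≤ M₃) :
    ∃ K M, EscapeData (hamVec fun Y => (p Y).im) (fun Y => (p Y).re) K M := by
  have hM₂0 : 0 ≤ M₂ := (norm_nonneg _).trans (hM₂ 0)
  have hM₃0 : 0 ≤ M₃ := (norm_nonneg _).trans (hM₃ 0)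
  have hs := hp.smooth
  have hds : ContDiff ℝ ∞ (fderiv ℝ p) := hs.fderiv_right (by simp)
  let Λ : (Phase n →L[ℝ] ℂ) →L[ℝ] Phase n :=
    (hamMap n).comp (ContinuousLinearMap.compL ℝ (Phase n) ℂ ℝ Complex.imCLM)
  have hv : (hamVec fun Y => (p Y).im) = Λ ∘ fderiv ℝ p := funext fun X => hamVec_im_eq hs X
  have hre : (fun Y => (p Y).re) = Complex.reCLM ∘ p := rfl
  -- The field already contains one derivative of `p`, so its second derivatives require the third
  -- derivatives of `p`, bounded by `M₃`.
  refine ⟨(‖hamMap n‖ * M₂).toNNReal, M₂ + ‖Λ‖ * M₃, ?_, ?_, lipschitzWith_hamVec_im hs hM₂, ?_,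
    Complex.reCLM.contDiff.comp hs, hp.re_nonneg, ?_, ?_, ?_⟩
  · rw [hv]
    exact Λ.contDiff.comp hds
  · rw [Real.coe_toNNReal _ (by positivity)]
    exact hp.norm_hamVec_im_le hM₂
  · intro X
    rw [hv]
    refine (Λ.norm_iteratedFDeriv_comp_left (N := ∞) hds.contDiffAt two_le_infty).trans ?_
    rw [norm_iteratedFDeriv_fderiv]
    have := hM₃ X
    have : ‖Λ‖ * ‖iteratedFDeriv ℝ (2 + 1) p X‖ ≤ ‖Λ‖ * M₃ := by gcongr
    linarith
  · intro X
    have h1 := norm_taylor_one_le hs hM₂ 0 X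
    rw [hp.fderiv_zero, hp.map_zero, sub_zero, sub_zero, zero_apply, sub_zero] at h1
    have h2 := (Complex.abs_re_le_norm _).trans h1
    refine h2.trans ?_
    gcongr
    linarith [mul_nonneg (norm_nonneg Λ) hM₃0]
  · intro X
    have h1 := norm_fderiv_sub_le hs hM₂ 0 X
    rw [hp.fderiv_zero, sub_zero, sub_zero] at h1
    have h3 : fderiv ℝ (fun Y => (p Y).re) X = Complex.reCLM.comp (fderiv ℝ p X) :=
      fderiv_clm_comp Complex.reCLM hs X
    rw [h3]
    have h2 : ‖Complex.reCLM.comp (fderiv ℝ p X)‖ ≤ ‖fderiv ℝ p X‖ := by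
      simpa using Complex.reCLM.opNorm_comp_le (fderiv ℝ p X)
    refine (h2.trans h1).trans ?_
    gcongr
    linarith [mul_nonneg (norm_nonneg Λ) hM₃0]
  · intro X
    rw [hre]
    refine (Complex.reCLM.norm_iteratedFDeriv_comp_left (N := ∞) hs.contDiffAt
      two_le_infty).trans ?_
    rw [Complex.reCLM_norm, one_mul]
    linarith [hM₂ X, mul_nonneg (norm_nonneg Λ) hM₃0]

/-- Together with `half_le_mul_weight` this turns the single quantity `μ` into the two regimes of
the conclusion. -/
theorem half_sq_le_mul_weight {E : Type*} [NormedAddCommGroup E] {ε : ℝ} (hε : 0 < ε) {x : E}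
    (hx : ‖x‖ ≤ √ε) : ‖x‖ ^ 2 / 2 ≤ ε * ‖x‖ ^ 2 * weight ε x := by
  have h1 : ‖x‖ ^ 2 ≤ ε := by
    calc ‖x‖ ^ 2 ≤ √ε ^ 2 := by gcongr
      _ = ε := Real.sq_sqrt hε.le
  unfold weight
  rw [← div_eq_mul_inv, le_div_iff₀ (by positivity)]
  nlinarith [sq_nonneg ‖x‖]

theorem half_le_mul_weight {E : Type*} [NormedAddCommGroup E] {ε : ℝ} (hε : 0 < ε) {x : E}
    (hx : √ε ≤ ‖x‖) : ε / 2 ≤ ε * ‖x‖ ^ 2 * weight ε x := by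
  have h1 : ε ≤ ‖x‖ ^ 2 := by
    calc ε = √ε ^ 2 := (Real.sq_sqrt hε.le).symm
      _ ≤ ‖x‖ ^ 2 := by gcongr
  unfold weight
  rw [← div_eq_mul_inv, le_div_iff₀ (by positivity)]
  nlinarith

end Main

end PhaseSpaceWeights

open PhaseSpaceWeights in
theorem mainTheorem2 (n : ℕ) (T : ℝ) (p₀ : Phase n → ℂ) (pExt : CPhase n → ℂ)
    (hp₀ : PrincipalSymbolAssumptions p₀ T)
    (hp₀_symbol : SymbolClass (fun _ => 1) p₀)
    (hExt : IsAlmostHolomorphicExtension p₀ pExt)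
    (hExt_symbol : SymbolClass (fun _ => 1) pExt)
    (hExt_supp : ∃ r : ℝ, tsupport pExt ⊆ {Z | ‖imPart Z‖ ≤ r}) :
    ∃ (C ε₀ δ₀ : ℝ) (G : ℝ → Phase n → ℝ), 0 < C ∧ 0 < ε₀ ∧ 0 < δ₀ ∧
      ∀ ε : ℝ, 0 < ε → ε ≤ ε₀ →
        ContDiff ℝ ∞ (G ε) ∧ HasCompactSupport (G ε) ∧
        (∀ k : ℕ, k ≤ 2 → ∀ X : Phase n,
          ‖iteratedFDeriv ℝ k (G ε) X‖ ≤ C * ε ^ (1 - (k : ℝ) / 2)) ∧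
        ∀ δ : ℝ, 0 < δ → δ ≤ δ₀ → ∀ X : Phase n,
          (‖X‖ ≤ √ε → δ * ‖X‖ ^ 2 / C ≤ (pExt (complexPoint X (δ • hamVec (G ε) X))).re) ∧
          (√ε ≤ ‖X‖ → δ * ε / C ≤ (pExt (complexPoint X (δ • hamVec (G ε) X))).re) := by
  have hT := hp₀.time_pos
  have hbound : ∀ k : ℕ, ∃ M : ℝ, ∀ X, ‖iteratedFDeriv ℝ k p₀ X‖ ≤ M := fun k => by
    simpa using hp₀_symbol.2 k
  have hboundE : ∀ k : ℕ, ∃ M : ℝ, ∀ Z, ‖iteratedFDeriv ℝ k pExt Z‖ ≤ M := fun k => by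
    simpa using hExt_symbol.2 k
  obtain ⟨M₁, hM₁⟩ := hbound 1
  obtain ⟨M₂, hM₂⟩ := hbound 2
  obtain ⟨M₃, hM₃⟩ := hbound 3
  obtain ⟨L₁, hL₁⟩ := hboundE 1
  obtain ⟨L₂, hL₂⟩ := hboundE 2
  have hL₁0 : 0 ≤ L₁ := (norm_nonneg _).trans (hL₁ 0)
  have hL₂0 : 0 ≤ L₂ := (norm_nonneg _).trans (hL₂ 0)
  obtain ⟨R, hR, hell⟩ := hp₀.elliptic_at_infinity
  obtain ⟨K, M, hdata⟩ := hp₀.exists_escapeData hM₂ hM₃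
  obtain ⟨c, hc, hcurve⟩ := hp₀.exists_integral_curve_lower_bound hM₁ hM₂ hM₃ R
  obtain ⟨C, c', G, hC, hc', hG⟩ := hdata.exists_escape_function (S := 2 * T) (by positivity)
    hR.le hc fun X hX => by
      obtain ⟨γ, hγ⟩ := exists_hamCurve hp₀.smooth hM₁ hM₂ X
      exact ⟨γ, hγ.1, hγ.2, hcurve X γ hX hγ⟩
  set q := ‖imEmbedding n‖ * ‖hamMap n‖ with hq
  have hq0 : 0 ≤ q := by positivity
  -- `C` serves the derivative bounds, `4 / c'` the region `‖X‖ ≤ R` (half of `c'` lost to the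
  -- remainder, another half in passing from `μ`), and `2R` the elliptic region.
  set C' := C + 4 / c' + 2 * R with hC'
  have hC'0 : 0 < C' := by positivity
  -- The bounds on `δ` ensure respectively `(1 - δ) Re p ≥ 0`, a quadratic remainder at most
  -- `δc'μ/2`, and a first-order loss at most half of the elliptic lower bound `1/R`.
  refine ⟨C', 1, min 1 (min (c' / (2 * (L₂ * q ^ 2 * C + 1))) (1 / (2 * R * (L₁ * q * C + 1)))),
    G, hC'0, one_pos, by positivity, fun ε hε hε1 => ?_⟩
  obtain ⟨hs, hcs, hder, hpos⟩ := hG ε hε hε1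
  refine ⟨hs, hcs, fun k hk X => (hder k hk X).trans ?_, fun δ hδ hδ₀ X => ?_⟩
  · gcongr
    rw [hC']
    have : 0 < 4 / c' := by positivity
    linarith
  simp only [le_min_iff] at hδ₀
  obtain ⟨hδ1, hδ2, hδ3⟩ := hδ₀
  rw [le_div_iff₀ (by positivity)] at hδ2 hδ3
  rcases le_or_gt ‖X‖ R with hX | hX
  · obtain ⟨hgrad, hesc⟩ := hpos X hX
    have hTay := hExt.le_re_complexPoint hp₀.smooth hL₂ (G ε) X hδ.le
    have hw := weight_pos hε X
    set μ := ε * ‖X‖ ^ 2 * weight ε X with hμ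
    have hμ0 : 0 ≤ μ := by positivity
    have herr : L₂ * (‖imEmbedding n‖ * (δ * (‖hamMap n‖ * ‖fderiv ℝ (G ε) X‖))) ^ 2 ≤
        δ * (c' / 2) * μ := by
      calc _ = L₂ * q ^ 2 * δ ^ 2 * ‖fderiv ℝ (G ε) X‖ ^ 2 := by rw [hq]; ring
        _ ≤ L₂ * q ^ 2 * δ ^ 2 * (C * μ) := by gcongr
        _ = δ * (δ * (L₂ * q ^ 2 * C)) * μ := by ring
        _ ≤ δ * (c' / 2) * μ := by
            gcongr
            linarith
    have hesc' := mul_le_mul_of_nonneg_left hesc hδ.le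
    -- The `-a` in the escape inequality is paid for by the full `Re p` in the Taylor expansion.
    have ha : 0 ≤ (1 - δ) * (p₀ X).re := mul_nonneg (by linarith) (hp₀.re_nonneg X)
    have hmain : δ * (c' / 2) * μ ≤ (pExt (complexPoint X (δ • hamVec (G ε) X))).re := by
      linarith
    have hC'c : 4 / c' ≤ C' := by rw [hC']; linarith
    have hkey : ∀ s : ℝ, 0 ≤ s → s / 2 ≤ μ →
        δ * s / C' ≤ (pExt (complexPoint X (δ • hamVec (G ε) X))).re := by
      intro s hs0 hs
      refine le_trans ?_ hmain
      calc δ * s / C' ≤ δ * s / (4 / c') := by gcongr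
        _ = δ * (c' / 2) * (s / 2) := by field_simp; ring
        _ ≤ _ := by gcongr
    exact ⟨fun h => hkey _ (by positivity) (half_sq_le_mul_weight hε h),
      fun h => hkey _ hε.le (half_le_mul_weight hε h)⟩
  · have hTay := hExt.re_sub_le_re_complexPoint hL₁ (G ε) X hδ.le
    have hgrad : ‖fderiv ℝ (G ε) X‖ ≤ C := by
      rw [← norm_iteratedFDeriv_one]
      refine (hder 1 (by norm_num) X).trans (mul_le_of_le_one_right hC.le ?_)
      exact Real.rpow_le_one hε.le hε1 (by norm_num)
    have herr : L₁ * (‖imEmbedding n‖ * (δ * (‖hamMap n‖ * ‖fderiv ℝ (G ε) X‖))) ≤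
        1 / (2 * R) := by
      calc _ = L₁ * q * δ * ‖fderiv ℝ (G ε) X‖ := by rw [hq]; ring
        _ ≤ L₁ * q * δ * C := by gcongr
        _ ≤ 1 / (2 * R) := by
            rw [le_div_iff₀ (by positivity)]
            have : 0 ≤ 2 * R * δ := by positivity
            linarith
    have hlow := hell X hX.le
    have hmain : 1 / (2 * R) ≤ (pExt (complexPoint X (δ • hamVec (G ε) X))).re := by
      have : 1 / R = 1 / (2 * R) + 1 / (2 * R) := by field_simp; norm_num
      linarith
    have hfar : δ * ε / C' ≤ (pExt (complexPoint X (δ • hamVec (G ε) X))).re := by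
      refine le_trans ?_ hmain
      have h1 : 2 * R ≤ C' := by
        have : 0 < 4 / c' := by positivity
        rw [hC']; linarith
      have h2 : δ * ε ≤ 1 := mul_le_one₀ hδ1 hε.le hε1
      gcongr
    -- Nothing relates `R` to `√ε`, so `‖X‖ ≤ √ε` may still occur here; then `‖X‖² ≤ ε` reduces it
    -- to the other bound.
    refine ⟨fun h => le_trans ?_ hfar, fun _ => hfar⟩
    have h1 : ‖X‖ ^ 2 ≤ ε := by
      calc ‖X‖ ^ 2 ≤ √ε ^ 2 := by gcongr
        _ = ε := Real.sq_sqrt hε.le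
    gcongr
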